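/- Let $\Pi$ be a profinite group and let $B\Pi$ be the category of finite sets with a continuous action of $\Pi$, endowed with its natural topology (covering families $=$ jointly surjective families). Let $\mathcal{A}$ be a contravariant pseudo-functor from $B\Pi$ to categories such that every $\mathcal{A}(S)$ is an additive category and every $f^*:\mathcal{A}(S)\to\mathcal{A}(T)$, for $f:T\to S$ in $B\Pi$, is an additive functor. We say that $\mathcal{A}$ is a *stack* if for all $S\in B\Pi$ and $A,B\in\mathcal{A}(S)$ the presheaf $(f:U\to S)\mapsto \operatorname{Hom}_{\mathcal{A}(U)}(f^*A,f^*B)$ on $B\Pi/S$ is a sheaf, and all descent data relative to covering families are effective. We say that $\mathcal{A}$ *commutes with coproducts* if for every finite family $(S_i)$ in $B\Pi$ (possibly empty) the functor $\mathcal{A}(\coprod_i S_i)\to\prod_i\mathcal{A}(S_i)$ is an equivalence. Call $\Pi$-sets connected if they are nonempty and transitive. A morphism $f:T\to S$ of connected $\Pi$-sets is a *Galois covering* if $\Gamma=\operatorname{Gal}(f)=\operatorname{Aut}_S(T)$ acts transitively on the fibres of $f$. For $g\in\Gamma$ let $i_g:g^*f^*\overset{\sim}{\Rightarrow}f^*$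 be the isomorphism given by $fg=f$ and the pseudo-functor structure. The functor $f^*$ is *Cartesian* if it has a right adjoint $f_*$ (with unit $\eta$ and counit $\epsilon$) and if for every $C\in\mathcal{A}(T)$ the morphism $$f^*f_*C\longrightarrow\bigoplus_{g\in\Gamma}g^*C\qquad(\ast)$$ with components $g^*(\epsilon_C)\circ i_g(f_*C)^{-1}$ is an isomorphism. If $f^*$ is Cartesian, a *trace structure* on $f^*$ is a natural transformation $\operatorname{tr}:f_*f^*\Rightarrow\operatorname{Id}_{\mathcal{A}(S)}$ such that, for every $A\in\mathcal{A}(S)$: (1) $\operatorname{tr}_A\circ\eta_A$ is multiplication by $|\Gamma|$ on $A$; (2) the isomorphism $f^*f_*f^*A\overset{\sim}{\to}\bigoplus_{g\in\Gamma}f^*A$, obtained by composing $(\ast)$ for $C=f^*A$ with $\bigoplus_g i_g(A)$, converts $f^*(\operatorname{tr}_A)$ into the sum map. **Theorem.** a) If $\mathcal{A}$ is a stack, then (i) $\mathcal{A}$ commutes with coproducts; (ii) for any Galois covering $f:T\to S$ of connected $\Pi$-sets, $f^*$ is Cartesian and has a trace structure. b) Suppose that $\mathcal{A}(S)$ is pseudo-abelian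 (idempotent complete) for all $S\in B\Pi$, and that $\mathcal{A}$ is $\mathbf{Z}[1/|\operatorname{Gal}(f)|]$-linear, i.e. all categories $\mathcal{A}(S)$ are, for every Galois covering $f:T\to *$ of the one-point $\Pi$-set $*$ with $T$ connected (for example, that all $\mathcal{A}(S)$ are $\mathbf{Q}$-linear). Then, conversely, (i) and (ii) imply that $\mathcal{A}$ is a stack. -/

import Mathlib

open CategoryTheory Limits Opposite Bicategory

open scoped FintypeCatDiscrete

universe v' u' v u

noncomputable section

/-! ### Finite continuous sets over a topological group -/

namespace BPi

/-- The category of finite sets (with the discrete topology) with a continuous action of `G`.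
For a profinite group `G`, this is its classifying topos (of finite objects). -/
abbrev FinContSet (G : Type u) [Group G] [TopologicalSpace G] :=
  ContAction FintypeCat.{u} G

variable {G : Type u} [Group G] [TopologicalSpace G]

/-- The natural topology: it is generated by the jointly surjective families. -/
def naturalTopology (G : Type u) [Group G] [TopologicalSpace G] :
    GrothendieckTopology (FinContSet G) :=
  (Types.jointlySurjectivePrecoverage.{u}.comap (forget (FinContSet G))).toGrothendieck

/-- A finite continuous `G`-set is connected if `G` acts transitively on it
(in particular, it is not empty). -/
structure IsTransitive (S : FinContSet G) : Prop where
  nonempty : Nonempty S.obj.V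
  isPretransitive : MulAction.IsPretransitive G S.obj.V

/-- The Galois group of a morphism `f : T ⟶ S` in a category: the automorphisms of `T` over `S`. -/
abbrev Gal {C : Type u} [Category.{v} C] {T S : C} (f : T ⟶ S) := Aut (Over.mk f)

/-- `f : T ⟶ S` is a Galois covering of connected `G`-sets: `S` and `T` are connected and the
automorphisms of `T` over `S` act transitively on the fibres of `f`. -/
structure IsGaloisCovering {T S : FinContSet G} (f : T ⟶ S) : Prop where
  source : IsTransitive T
  target : IsTransitive S
  exists_eq : ∀ x y : T.obj.V, f.hom.hom x = f.hom.hom y →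
    ∃ g : Gal f, g.hom.left.hom.hom x = y

instance {T S : FinContSet G} (f : T ⟶ S) : Finite (Gal f) := by
  have : Finite (T.obj.V → T.obj.V) := inferInstance
  refine Finite.of_injective (β := T.obj.V → T.obj.V) (fun g x ↦ g.hom.left.hom.hom x) ?_
  intro g h hgh
  ext : 2
  apply ObjectProperty.hom_ext
  apply Action.Hom.ext
  apply FintypeCat.hom_ext
  intro x
  exact congrFun hgh x

end BPi

/-! ### Pseudofunctors -/

namespace BPi

variable {C : Type u} [Category.{v} C] (𝒜 : LocallyDiscrete Cᵒᵖ ⥤ᵖ Cat.{v', u'})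

/-- The category `𝒜(S)`. -/
abbrev fibre (S : C) : Type u' := 𝒜.obj (.mk (op S))

/-- The functor `f^* : 𝒜(S) ⥤ 𝒜(T)`. -/
abbrev pull {T S : C} (f : T ⟶ S) : fibre 𝒜 S ⥤ fibre 𝒜 T := (𝒜.map f.op.toLoc).toFunctor

/-- `𝒜` commutes with (finite) coproducts: it transforms them into products of categories. -/
def CommutesWithCoproducts : Prop :=
  ∀ ⦃ι : Type⦄ [Finite ι] (X : ι → C) (c : Cofan X), Nonempty (IsColimit c) →
    (Functor.pi' fun i ↦ pull 𝒜 (c.inj i)).IsEquivalence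

/-- The isomorphism `i_g : g^* f^* ≅ f^*` for `g` in the Galois group of `f`. -/
def galIso {T S : C} (f : T ⟶ S) (g : Gal f) :
    pull 𝒜 f ⋙ pull 𝒜 g.hom.left ≅ pull 𝒜 f :=
  (Cat.Hom.toNatIso (𝒜.mapComp' f.op.toLoc g.hom.left.op.toLoc f.op.toLoc
    (by rw [← Quiver.Hom.comp_toLoc, ← op_comp]; simpa using
      congrArg (fun h : T ⟶ S ↦ h.op.toLoc) (Over.w g.hom)))).symm

variable [∀ S : C, Preadditive (fibre 𝒜 S)] [∀ S : C, HasFiniteBiproducts (fibre 𝒜 S)]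

section

variable {𝒜} {T S : C} {f : T ⟶ S} [Finite (Gal f)] {R : fibre 𝒜 T ⥤ fibre 𝒜 S}
  (adj : pull 𝒜 f ⊣ R)

/-- The morphism `f^* f_* D ⟶ ⨁_g g^* D` whose `g`-component is
`f^* f_* D ≅ g^* f^* f_* D ⟶ g^* D`, where the second arrow is `g^*` of the counit. -/
def cartesianMap (D : fibre 𝒜 T) :
    (pull 𝒜 f).obj (R.obj D) ⟶ ⨁ fun g : Gal f ↦ (pull 𝒜 g.hom.left).obj D :=
  biproduct.lift fun g ↦
    (galIso 𝒜 f g).inv.app (R.obj D) ≫ (pull 𝒜 g.hom.left).map (adj.counit.app D)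

/-- The composition of `cartesianMap` for `D = f^* A` with the isomorphisms
`i_g(A) : g^* f^* A ≅ f^* A`. -/
def cartesianMapPull (A : fibre 𝒜 S) :
    (pull 𝒜 f).obj (R.obj ((pull 𝒜 f).obj A)) ⟶ ⨁ fun _ : Gal f ↦ (pull 𝒜 f).obj A :=
  cartesianMap adj ((pull 𝒜 f).obj A) ≫ biproduct.map fun g ↦ (galIso 𝒜 f g).hom.app A

/-- A trace structure `tr : f_* f^* ⟶ 𝟭` on `f^*`, with respect to a right adjoint `f_*`. -/
structure TraceStructure where
  tr : pull 𝒜 f ⋙ R ⟶ 𝟭 (fibre 𝒜 S)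
  unit_tr (A : fibre 𝒜 S) : adj.unit.app A ≫ tr.app A = Nat.card (Gal f) • 𝟙 A
  map_tr (A : fibre 𝒜 S) : (pull 𝒜 f).map (tr.app A) =
    cartesianMapPull adj A ≫ biproduct.desc fun _ ↦ 𝟙 ((pull 𝒜 f).obj A)

end

/-- `f^*` has a right adjoint, is Cartesian, and has a trace structure. -/
def IsCartesianWithTrace {T S : C} (f : T ⟶ S) [Finite (Gal f)] : Prop :=
  ∃ (R : fibre 𝒜 T ⥤ fibre 𝒜 S) (adj : pull 𝒜 f ⊣ R),
    (∀ D : fibre 𝒜 T, IsIso (cartesianMap adj D)) ∧ Nonempty (TraceStructure adj)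

end BPi

end

/-! ### Finite continuous sets -/

namespace BPi

namespace FinContSet

variable {G : Type u} [Group G] [TopologicalSpace G]

/-! For a Galois covering `f : T ⟶ S` with group Γ, two maps from a connected set to `T` over `S`
differ by a unique element of Γ; informally, `T ×_S T` is a disjoint union of copies of `T` indexed
by Γ. Once `𝒜` commutes with coproducts, morphisms can be tested and built orbit by orbit, so a
descent datum along `f` is an object `M` of `𝒜(T)` with compatible isomorphisms `g^* M ≅ h^* M`, and
its morphisms are the Γ-equivariant ones.

Part a). In a coproduct the overlaps of distinct summands are empty, and the empty family covers the
empty set, so descent data along the inclusions are mere families of objects. For a Galois covering,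
`⨁ g, g^* M` carries a tautological descent datum permuting the summands. The object to which it
descends is `f_* M`: a map `N ⟶ f_* M` is a Γ-invariant family of maps `f^* N ⟶ g^* M`, hence
determined by its component at 1. The sum of the Γ-conjugates of the counit is invariant and
descends to the trace (`nonempty_galCone`, `GalCone.exists_adjunction`, `nonempty_traceStructure`).

Part b). Averaging replaces descent. Faithfulness of `f^*` follows from `tr ∘ η = |Γ|`; an invariant
`x` descends to `|Γ|⁻¹ tr ∘ f_* x ∘ η`; a descent datum on `M` makes Γ act on `f_* M`, and the image
of the averaging idempotent pulls back to `M` (`TraceStructure.exists_isIso_of_descentData`).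
General coverings reduce to this case: quotients of `G` by small open normal subgroups refine every
covering sieve and are Galois over each orbit. -/

lemma isOpen_stabilizer (S : FinContSet G) (x : S.obj.V) :
    IsOpen (MulAction.stabilizer G x : Set G) := by
  have h := S.property
  rw [Action.isContinuous_def] at h
  have : Continuous (fun g : G ↦ (show S.obj.V from g • x)) :=
    h.comp (by fun_prop : Continuous (fun g : G ↦ ((g, x) : G × S.obj.V)))
  exact (isOpen_discrete ({x} : Set S.obj.V)).preimage this

/-- The object of `FinContSet G` attached to a finite `G`-set with open stabilizers. -/
noncomputable def ofMulAction [IsTopologicalGroup G] (X : Type u) [Finite X] [MulAction G X]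
    (h : ∀ x : X, IsOpen (MulAction.stabilizer G x : Set G)) : FinContSet G :=
  ⟨Action.FintypeCat.ofMulAction G (H := FintypeCat.of X), by
    rw [Action.isContinuous_def]
    let _ : TopologicalSpace X := ⊥
    have : DiscreteTopology X := ⟨rfl⟩
    exact ((continuousSMul_iff_stabilizer_isOpen (M := G) (X := X)).2 h).1⟩

/-- Constructor for morphisms in `FinContSet G`. -/
def homMk {S T : FinContSet G} (φ : S.obj.V → T.obj.V)
    (h : ∀ (g : G) (x : S.obj.V), φ (g • x) = g • φ x) : S ⟶ T :=
  ObjectProperty.homMk ⟨FintypeCat.homMk φ, fun g ↦ by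
    ext x; exact h g x⟩

@[simp]
lemma homMk_apply {S T : FinContSet G} (φ : S.obj.V → T.obj.V)
    (h : ∀ (g : G) (x : S.obj.V), φ (g • x) = g • φ x) (x : S.obj.V) :
    (homMk φ h).hom.hom x = φ x := rfl

lemma hom_smul {S T : FinContSet G} (f : S ⟶ T) (g : G) (x : S.obj.V) :
    f.hom.hom (g • x) = g • f.hom.hom x :=
  ConcreteCategory.congr_hom (f.hom.comm g) x

lemma hom_ext {S T : FinContSet G} {f f' : S ⟶ T}
    (h : ∀ x, f.hom.hom x = f'.hom.hom x) : f = f' := by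
  apply ObjectProperty.hom_ext
  apply Action.Hom.ext
  apply FintypeCat.hom_ext
  exact h

@[simp]
lemma comp_apply {S T U : FinContSet G} (f : S ⟶ T) (f' : T ⟶ U) (x : S.obj.V) :
    (f ≫ f').hom.hom x = f'.hom.hom (f.hom.hom x) := rfl

lemma hom_ext_of_isTransitive {S T : FinContSet G} (hS : IsTransitive S) {f f' : S ⟶ T}
    (x : S.obj.V) (h : f.hom.hom x = f'.hom.hom x) : f = f' := by
  have := hS.isPretransitive
  refine hom_ext fun y ↦ ?_
  obtain ⟨g, rfl⟩ := MulAction.exists_smul_eq G x y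
  rw [hom_smul, hom_smul, h]

/-! ### Coproducts as disjoint unions; orbit decompositions -/

section Coproducts

variable {ι : Type} {X : ι → FinContSet G}

/-- The map from the disjoint union to the point of a cofan. -/
def cofanMap (c : Cofan X) (p : Σ i, (X i).obj.V) : c.pt.obj.V := (c.inj p.1).hom.hom p.2

lemma nonempty_isColimit_of_bijective (c : Cofan X) (hc : Function.Bijective (cofanMap c)) :
    Nonempty (IsColimit c) := by
  let e := Equiv.ofBijective _ hc
  have he (i : ι) (x : (X i).obj.V) : e.symm ((c.inj i).hom.hom x) = ⟨i, x⟩ :=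
    e.symm_apply_eq.2 rfl
  refine ⟨Cofan.IsColimit.mk c (fun t ↦ homMk (fun y ↦ cofanMap t (e.symm y)) ?_) ?_ ?_⟩
  · intro g y
    obtain ⟨⟨i, x⟩, rfl⟩ := e.surjective y
    rw [Equiv.symm_apply_apply]
    change cofanMap t (e.symm (g • (c.inj i).hom.hom x)) = _
    rw [← hom_smul, he]
    exact hom_smul _ _ _
  · intro t i
    refine hom_ext fun x ↦ ?_
    rw [comp_apply, homMk_apply, he]
    rfl
  · intro t m hm
    refine hom_ext fun y ↦ ?_
    obtain ⟨⟨i, x⟩, rfl⟩ := e.surjective y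
    rw [homMk_apply, Equiv.symm_apply_apply]
    exact congr(($(hm i)).hom.hom x)

/-- An empty `G`-set is the coproduct of the empty family. -/
lemma isColimit_of_isEmpty (Y : FinContSet G) [IsEmpty Y.obj.V] (X : Empty → FinContSet G) :
    Nonempty (IsColimit (Cofan.mk Y (fun i : Empty ↦ (i.elim : X i ⟶ Y)))) :=
  nonempty_isColimit_of_bijective _ ⟨fun p ↦ p.1.elim, fun y ↦ isEmptyElim (α := Y.obj.V) y⟩

variable [IsTopologicalGroup G]

/-- The disjoint union with the summandwise action is itself a finite continuous `G`-set, because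
the stabilizer of `⟨i, x⟩` is that of `x`. Any other coproduct is isomorphic to it. -/
lemma bijective_of_isColimit [Finite ι] {c : Cofan X} (hc : IsColimit c) :
    Function.Bijective (cofanMap c) := by
  let _ : MulAction G (Σ i, (X i).obj.V) :=
    { smul := fun g p ↦ ⟨p.1, g • p.2⟩
      one_smul := fun ⟨i, x⟩ ↦ Sigma.ext rfl (heq_of_eq (one_smul G x))
      mul_smul := fun g h ⟨i, x⟩ ↦ Sigma.ext rfl (heq_of_eq (mul_smul g h x)) }
  let U : FinContSet G := ofMulAction (Σ i, (X i).obj.V) (by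
    rintro ⟨i, x⟩
    convert isOpen_stabilizer (X i) x using 1
    ext g
    simp only [SetLike.mem_coe, MulAction.mem_stabilizer_iff]
    change (⟨i, g • x⟩ : Σ i, (X i).obj.V) = ⟨i, x⟩ ↔ _
    simp)
  let c' : Cofan X := Cofan.mk U (fun i ↦ homMk (fun x ↦ (⟨i, x⟩ : Σ i, (X i).obj.V))
    (fun g x ↦ rfl))
  have hc' : Function.Bijective (cofanMap c') := Function.bijective_id
  obtain ⟨h'⟩ := nonempty_isColimit_of_bijective c' hc'
  let e := hc.coconePointUniqueUpToIso h'
  have h₁ (p) : e.hom.hom.hom (cofanMap c p) = cofanMap c' p :=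
    congr(($(hc.comp_coconePointUniqueUpToIso_hom h' ⟨p.1⟩)).hom.hom p.2)
  have h₂ (p) : e.inv.hom.hom (cofanMap c' p) = cofanMap c p :=
    congr(($(hc.comp_coconePointUniqueUpToIso_inv h' ⟨p.1⟩)).hom.hom p.2)
  refine ⟨fun p q hpq ↦ hc'.1 ?_, fun y ↦ ?_⟩
  · rw [← h₁, ← h₁, hpq]
  · obtain ⟨p, hp⟩ := hc'.2 (e.hom.hom.hom y)
    refine ⟨p, ?_⟩
    rw [← h₂, hp]
    exact congr(($(e.hom_inv_id)).hom.hom y)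

variable (Y : FinContSet G)

/-- Any finite continuous `G`-set is a finite coproduct of connected ones. -/
lemma exists_isTransitive_cofan : ∃ (ι : Type) (_ : Finite ι) (X : ι → FinContSet G)
    (c : ∀ i, X i ⟶ Y), Nonempty (IsColimit (Cofan.mk Y c)) ∧ ∀ i, IsTransitive (X i) := by
  obtain ⟨n, ⟨e⟩⟩ := Finite.exists_equiv_fin (MulAction.orbitRel.Quotient G Y.obj.V)
  let X (i : Fin n) : FinContSet G :=
    ofMulAction (MulAction.orbitRel.Quotient.orbit (e.symm i)) (by
      intro x
      convert isOpen_stabilizer Y x.1 using 1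
      ext g
      simp only [SetLike.mem_coe, MulAction.mem_stabilizer_iff]
      exact Subtype.ext_iff)
  refine ⟨Fin n, inferInstance, X, fun i ↦ homMk (fun x ↦ x.1) (fun g x ↦ rfl),
    nonempty_isColimit_of_bijective _ ⟨?_, ?_⟩, fun i ↦ ⟨?_, ?_⟩⟩
  · rintro ⟨i, x, hx⟩ ⟨j, y, hy⟩ (h : x = y)
    subst h
    obtain rfl : i = j := by
      rw [MulAction.orbitRel.Quotient.mem_orbit] at hx hy
      exact e.symm.injective (hx.symm.trans hy)
    rfl
  · intro y
    refine ⟨⟨e (Quotient.mk'' y), ⟨y, ?_⟩⟩, rfl⟩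
    rw [MulAction.orbitRel.Quotient.mem_orbit, Equiv.symm_apply_apply]
  · obtain ⟨y, hy⟩ := Quotient.exists_rep (e.symm i)
    exact ⟨⟨y, MulAction.orbitRel.Quotient.mem_orbit.2 hy⟩⟩
  · exact inferInstanceAs
      (MulAction.IsPretransitive G (MulAction.orbitRel.Quotient.orbit (e.symm i)))

end Coproducts

/-! ### Maps into a coproduct, as a substitute for fibre products over it -/

section Lifts

variable [IsTopologicalGroup G] {ι : Type} [Finite ι] {X : ι → FinContSet G} {c : Cofan X}

lemma mono_inj (hc : IsColimit c) {i : ι} {Z : FinContSet G} {a b : Z ⟶ X i}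
    (h : a ≫ c.inj i = b ≫ c.inj i) : a = b := by
  refine hom_ext fun z ↦ ?_
  have := (bijective_of_isColimit hc).1
    (a₁ := ⟨i, a.hom.hom z⟩) (a₂ := ⟨i, b.hom.hom z⟩) congr(($h).hom.hom z)
  simpa using this

lemma isEmpty_of_ne (hc : IsColimit c) {i j : ι} (hij : i ≠ j) {Z : FinContSet G}
    (a : Z ⟶ X i) (b : Z ⟶ X j) (h : a ≫ c.inj i = b ≫ c.inj j) : IsEmpty Z.obj.V := by
  refine ⟨fun z ↦ hij ?_⟩
  have := (bijective_of_isColimit hc).1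
    (a₁ := ⟨i, a.hom.hom z⟩) (a₂ := ⟨j, b.hom.hom z⟩) congr(($h).hom.hom z)
  exact congr($(this).1)

/-- The image of a transitive set is a single orbit, hence lies in one summand. -/
lemma exists_lift_of_isTransitive (hc : IsColimit c) {Z : FinContSet G} (hZ : IsTransitive Z)
    (a : Z ⟶ c.pt) : ∃ (i : ι) (b : Z ⟶ X i), b ≫ c.inj i = a := by
  obtain ⟨z⟩ := hZ.nonempty
  have := hZ.isPretransitive
  obtain ⟨⟨i, x⟩, hx⟩ := (bijective_of_isColimit hc).2 (a.hom.hom z)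
  have h (w : Z.obj.V) : ∃ y : (X i).obj.V, (c.inj i).hom.hom y = a.hom.hom w := by
    obtain ⟨g, rfl⟩ := MulAction.exists_smul_eq G z w
    exact ⟨g • x, by rw [hom_smul, hom_smul]; exact congr(g • $hx)⟩
  choose b hb using h
  refine ⟨i, homMk b fun g w ↦ ?_, hom_ext hb⟩
  have := (bijective_of_isColimit hc).1
    (a₁ := ⟨i, b (g • w)⟩) (a₂ := ⟨i, g • b w⟩) (by
      change (c.inj i).hom.hom _ = (c.inj i).hom.hom _
      rw [hb, hom_smul, hom_smul, hb])
  simpa using this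

end Lifts

/-! ### The torsor property of Galois coverings -/

section Galois

variable {T S : FinContSet G} {f : T ⟶ S}

/-- Equivariant maps from a transitive set are determined by one value, so transitivity of Γ on a
single fibre suffices. With `gal_ext`, this plays the role of the decomposition of `T ×_S T`. -/
lemma exists_gal (hf : IsGaloisCovering f) {Y : FinContSet G} (hY : IsTransitive Y) (f₁ f₂ : Y ⟶ T)
    (h : f₁ ≫ f = f₂ ≫ f) : ∃ g : Gal f, f₁ ≫ g.hom.left = f₂ := by
  obtain ⟨y⟩ := hY.nonempty
  obtain ⟨g, hg⟩ := hf.exists_eq (f₁.hom.hom y) (f₂.hom.hom y) congr(($h).hom.hom y)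
  exact ⟨g, hom_ext_of_isTransitive hY y hg⟩

lemma gal_ext (hf : IsGaloisCovering f) {Y : FinContSet G} (hY : IsTransitive Y) {f₁ : Y ⟶ T}
    {g g' : Gal f}
    (h : f₁ ≫ g.hom.left = f₁ ≫ g'.hom.left) : g = g' := by
  obtain ⟨y⟩ := hY.nonempty
  ext : 2
  exact hom_ext_of_isTransitive hf.source (f₁.hom.hom y) congr(($h).hom.hom y)

end Galois

/-! ### Quotients by open normal subgroups, as cofinal Galois coverings -/

section Quotients

variable [IsTopologicalGroup G]

/-- The kernel of the action on a finite continuous `G`-set, as an open normal subgroup. -/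
noncomputable def actionKer (S : FinContSet G) : OpenNormalSubgroup G :=
  { toSubgroup := (MulAction.toPermHom G S.obj.V).ker
    isOpen' := by
      have : ((MulAction.toPermHom G S.obj.V).ker : Set G) =
          ⋂ x : S.obj.V, (MulAction.stabilizer G x : Set G) := by
        ext g
        simp [MonoidHom.mem_ker, Equiv.Perm.ext_iff]
      change IsOpen ((MulAction.toPermHom G S.obj.V).ker : Set G)
      rw [this]
      exact isOpen_iInter_of_finite fun x ↦ isOpen_stabilizer S x
    isNormal' := inferInstance }

lemma smul_eq_of_mem_actionKer {S : FinContSet G} {g : G} (hg : g ∈ actionKer S) (x : S.obj.V) :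
    g • x = x := by
  have : g ∈ (MulAction.toPermHom G S.obj.V).ker := hg
  exact congr($(MonoidHom.mem_ker.1 this) x)

variable [CompactSpace G]

/-- The quotient of `G` by an open normal subgroup, as a finite continuous `G`-set. -/
noncomputable def quot (N : OpenNormalSubgroup G) : FinContSet G :=
  haveI : Finite (G ⧸ N.toSubgroup) := N.toSubgroup.quotient_finite_of_isOpen N.isOpen
  ofMulAction (G ⧸ N.toSubgroup) (by
    intro x
    induction x using QuotientGroup.induction_on with | H a
    refine Subgroup.isOpen_mono (H₁ := N.toSubgroup) (fun n hn ↦ ?_) N.isOpen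
    rw [MulAction.mem_stabilizer_iff]
    change QuotientGroup.mk (n * a) = QuotientGroup.mk a
    rw [eq_comm, QuotientGroup.eq]
    have := N.isNormal'.conj_mem n hn a⁻¹
    simpa [mul_assoc] using this)

/-- The base point of `quot N`. -/
def quotOne (N : OpenNormalSubgroup G) : (quot N).obj.V :=
  (QuotientGroup.mk 1 : G ⧸ N.toSubgroup)

lemma exists_smul_quotOne (N : OpenNormalSubgroup G) (x : (quot N).obj.V) :
    ∃ g : G, g • quotOne N = x := by
  induction x using QuotientGroup.induction_on (s := N.toSubgroup) with | H a
  refine ⟨a, ?_⟩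
  change (QuotientGroup.mk (a * 1) : G ⧸ N.toSubgroup) = _
  rw [mul_one]

lemma isTransitive_quot (N : OpenNormalSubgroup G) : IsTransitive (quot N) where
  nonempty := ⟨quotOne N⟩
  isPretransitive := ⟨fun x y ↦ by
    obtain ⟨g, rfl⟩ := exists_smul_quotOne N x
    obtain ⟨h, rfl⟩ := exists_smul_quotOne N y
    exact ⟨h * g⁻¹, by simp [mul_smul]⟩⟩

lemma exists_quot_hom {N : OpenNormalSubgroup G} {S : FinContSet G} (h : N ≤ actionKer S)
    (s : S.obj.V) : ∃ t : quot N ⟶ S, t.hom.hom (quotOne N) = s := by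
  have key (a b : G) (hab : a⁻¹ * b ∈ N.toSubgroup) : a • s = b • s := by
    have := smul_eq_of_mem_actionKer (h hab) s
    rw [mul_smul, inv_smul_eq_iff] at this
    exact this.symm
  let φ : G ⧸ N.toSubgroup → S.obj.V :=
    Quotient.lift (fun a : G ↦ a • s) (fun a b hab ↦ key a b (QuotientGroup.leftRel_apply.1 hab))
  refine ⟨homMk φ ?_, one_smul G s⟩
  intro g x
  induction x using QuotientGroup.induction_on (s := N.toSubgroup) with | H a
  exact mul_smul g a s

lemma le_actionKer_quot (N : OpenNormalSubgroup G) : N ≤ actionKer (quot N) := by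
  intro n hn
  change n ∈ (MulAction.toPermHom G (quot N).obj.V).ker
  rw [MonoidHom.mem_ker]
  ext x
  induction x using QuotientGroup.induction_on (s := N.toSubgroup) with | H a
  change QuotientGroup.mk (n * a) = QuotientGroup.mk a
  rw [eq_comm, QuotientGroup.eq]
  have := N.isNormal'.conj_mem n hn a⁻¹
  simpa [mul_assoc] using this

lemma isGaloisCovering_of_quot {N : OpenNormalSubgroup G} {S : FinContSet G}
    (hS : IsTransitive S) (f : quot N ⟶ S) : IsGaloisCovering f where
  source := isTransitive_quot N
  target := hS
  exists_eq x y hxy := by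
    obtain ⟨a, rfl⟩ := exists_smul_quotOne N x
    obtain ⟨b, rfl⟩ := exists_smul_quotOne N y
    -- An automorphism sending the class of `a` to that of `b` must send the base point to the class
    -- of `a⁻¹ * b`; normality of `N` makes this well defined.
    obtain ⟨t, ht⟩ := exists_quot_hom (le_actionKer_quot N) ((a⁻¹ * b) • quotOne N)
    obtain ⟨t', ht'⟩ := exists_quot_hom (le_actionKer_quot N) ((b⁻¹ * a) • quotOne N)
    rw [hom_smul, hom_smul] at hxy
    have hT := isTransitive_quot N
    let e : quot N ≅ quot N :=
      { hom := t
        inv := t'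
        hom_inv_id := hom_ext_of_isTransitive hT (quotOne N) (by
          simp only [comp_apply, ht, ht', hom_smul, smul_smul]
          simp)
        inv_hom_id := hom_ext_of_isTransitive hT (quotOne N) (by
          simp only [comp_apply, ht, ht', hom_smul, smul_smul]
          simp) }
    refine ⟨Over.isoMk e (hom_ext_of_isTransitive hT (quotOne N) ?_), ?_⟩
    · change f.hom.hom (t.hom.hom _) = f.hom.hom _
      rw [ht, hom_smul, mul_smul, ← hxy, inv_smul_smul]
    · change t.hom.hom _ = _
      rw [hom_smul, ht, smul_smul, mul_inv_cancel_left]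

/-- If `T` is a quotient of `G` by an open normal subgroup, the order of the Galois group of
any Galois covering `T ⟶ S` divides that of a Galois covering of the one-point set. -/
lemma exists_card_gal_dvd {N : OpenNormalSubgroup G} {S : FinContSet G} (f : quot N ⟶ S) :
    ∃ (P : FinContSet G) (_ : IsTerminal P) (p : quot N ⟶ P),
      IsGaloisCovering p ∧ Nat.card (Gal f) ∣ Nat.card (Gal p) := by
  let _ : MulAction G PUnit.{u + 1} :=
    { smul := fun _ x ↦ x
      one_smul := fun _ ↦ rfl
      mul_smul := fun _ _ _ ↦ rfl }
  let P : FinContSet G := ofMulAction PUnit.{u + 1} (by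
    intro x
    convert isOpen_univ
    ext g
    simp)
  have hP : IsTerminal P := IsTerminal.ofUniqueHom (fun S ↦ homMk (fun _ ↦ PUnit.unit)
    (fun _ _ ↦ rfl)) (fun S m ↦ hom_ext fun x ↦ rfl)
  have hPt : IsTransitive P := ⟨⟨PUnit.unit⟩, ⟨fun x y ↦ ⟨1, rfl⟩⟩⟩
  let s := hP.from S
  refine ⟨P, hP, f ≫ s, isGaloisCovering_of_quot hPt _, ?_⟩
  -- An automorphism over `S` is one over the point, so the divisibility is Lagrange's theorem.
  let φ : Gal f →* Gal (f ≫ s) := (Over.map s).mapAut _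
  refine Subgroup.card_dvd_of_injective φ fun g g' h ↦ ?_
  ext : 2
  exact congr(($h).hom.left)

end Quotients

/-! ### Covering sieves of the natural topology -/

section Topology

variable [IsTopologicalGroup G] [CompactSpace G]

lemma exists_apply_eq_of_mem_naturalTopology {S : FinContSet G} {R : Sieve S}
    (hR : R ∈ naturalTopology G S) (s : S.obj.V) :
    ∃ (Y : FinContSet G) (f : Y ⟶ S), R f ∧ ∃ y, f.hom.hom y = s := by
  induction hR with
  | of X R hR =>
    rw [Presieve.mem_comap_jointlySurjectivePrecoverage_iff] at hR
    obtain ⟨Y, f, hf, y, hy⟩ := hR s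
    exact ⟨Y, f, Sieve.le_generate _ _ _ hf, y, hy⟩
  | top X => exact ⟨X, 𝟙 X, trivial, s, rfl⟩
  | pullback X R _ Y f ih =>
    obtain ⟨Z, g, hg, z, hz⟩ := ih (f.hom.hom s)
    -- A point of the fibre product of `Y` and `Z` is realized by a single connected set mapping to
    -- both: a quotient of `G` acting trivially on neither side's complement is avoided by
    -- intersecting the two kernels.
    obtain ⟨t, ht⟩ := exists_quot_hom (inf_le_left : actionKer Y ⊓ actionKer Z ≤ _) s
    obtain ⟨t', ht'⟩ := exists_quot_hom (inf_le_right : actionKer Y ⊓ actionKer Z ≤ _) z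
    refine ⟨_, t, ?_, _, ht⟩
    have : t ≫ f = t' ≫ g := hom_ext_of_isTransitive (isTransitive_quot _) (quotOne _) (by
      simp [ht, ht', hz])
    rw [Sieve.pullback_apply, this]
    exact R.downward_closed hg _
  | transitive X R R' _ _ ih ih' =>
    obtain ⟨Y, f, hf, y, rfl⟩ := ih s
    obtain ⟨Z, g, hg, z, rfl⟩ := ih' hf y
    exact ⟨Z, g ≫ f, hg, z, rfl⟩

/-- Finitely many members of `R` already cover `S`. If `N` acts trivially on their sources, a map
from `quot N` factors through whichever member hits the image of the base point. -/
lemma exists_openNormalSubgroup_of_mem_naturalTopology {S : FinContSet G} {R : Sieve S}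
    (hR : R ∈ naturalTopology G S) :
    ∃ N : OpenNormalSubgroup G, N ≤ actionKer S ∧ ∀ t : quot N ⟶ S, R t := by
  choose Y f hf y hy using exists_apply_eq_of_mem_naturalTopology hR
  let M : OpenNormalSubgroup G :=
    { toSubgroup := ⨅ s, (actionKer (Y s)).toSubgroup
      isOpen' := by
        change IsOpen (((⨅ s, (actionKer (Y s)).toSubgroup) : Subgroup G) : Set G)
        rw [Subgroup.coe_iInf]
        exact isOpen_iInter_of_finite fun s ↦ (actionKer (Y s)).isOpen
      isNormal' := Subgroup.normal_iInf_normal fun s ↦ (actionKer (Y s)).isNormal' }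
  have hM (s) : M ≤ actionKer (Y s) := fun g hg ↦ Subgroup.mem_iInf.1 hg s
  refine ⟨actionKer S ⊓ M, inf_le_left, fun t ↦ ?_⟩
  let s := t.hom.hom (quotOne _)
  obtain ⟨t', ht'⟩ := exists_quot_hom ((inf_le_right : actionKer S ⊓ M ≤ M).trans (hM s)) (y s)
  have : t' ≫ f s = t := hom_ext_of_isTransitive (isTransitive_quot _) (quotOne _) (by
    simp [ht', hy, s])
  rw [← this]
  exact R.downward_closed (hf s) _

lemma ofArrows_mem_naturalTopology {S : FinContSet G} {ι : Type*} {X : ι → FinContSet G}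
    (f : ∀ i, X i ⟶ S) (hf : ∀ s : S.obj.V, ∃ i x, (f i).hom.hom x = s) :
    Sieve.ofArrows X f ∈ naturalTopology G S :=
  Precoverage.generate_mem_toGrothendieck
    ((Presieve.ofArrows_mem_comap_jointlySurjectivePrecoverage_iff _).2 fun s ↦ by
      obtain ⟨i, x, hx⟩ := hf s
      exact ⟨i, x, hx⟩)

end Topology

end FinContSet

end BPi

/-! ### Pullbacks of morphisms for a pseudofunctor to `Cat` -/

namespace BPi

open Pseudofunctor Pseudofunctor.LocallyDiscreteOpToCat

section

variable {C : Type u} [Category.{v} C] {𝒜 : LocallyDiscrete Cᵒᵖ ⥤ᵖ Cat.{v', u'}}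

section

variable {X₁ X₂ X₃ Y Y' : C} {M₁ : fibre 𝒜 X₁} {M₂ : fibre 𝒜 X₂} {M₃ : fibre 𝒜 X₃}
  {f₁ : Y ⟶ X₁} {f₂ : Y ⟶ X₂} {f₃ : Y ⟶ X₃}

lemma pullHom_comp (φ : (pull 𝒜 f₁).obj M₁ ⟶ (pull 𝒜 f₂).obj M₂)
    (ψ : (pull 𝒜 f₂).obj M₂ ⟶ (pull 𝒜 f₃).obj M₃) (g : Y' ⟶ Y)
    (gf₁ : Y' ⟶ X₁) (gf₂ : Y' ⟶ X₂) (gf₃ : Y' ⟶ X₃)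
    (h₁ : g ≫ f₁ = gf₁) (h₂ : g ≫ f₂ = gf₂) (h₃ : g ≫ f₃ = gf₃) :
    pullHom (φ ≫ ψ) g gf₁ gf₃ h₁ h₃ = pullHom φ g gf₁ gf₂ h₁ h₂ ≫ pullHom ψ g gf₂ gf₃ h₂ h₃ := by
  simp [pullHom]

@[simp]
lemma pullHom_map {M N : fibre 𝒜 X₁} (α : M ⟶ N) (g : Y' ⟶ Y)
    (gf₁ : Y' ⟶ X₁) (h₁ h₁' : g ≫ f₁ = gf₁) :
    pullHom (M₁ := M) (M₂ := N) ((pull 𝒜 f₁).map α) g gf₁ gf₁ h₁ h₁' = (pull 𝒜 gf₁).map α := by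
  simp only [pullHom]
  exact mapComp'_naturality_2 _ _ _ _ _ _

@[simp]
lemma pullHom_id_hom (M : fibre 𝒜 X₁) (g : Y' ⟶ Y)
    (gf₁ : Y' ⟶ X₁) (h₁ h₁' : g ≫ f₁ = gf₁) :
    pullHom (𝟙 ((pull 𝒜 f₁).obj M)) g gf₁ gf₁ h₁ h₁' = 𝟙 _ := by
  simpa using pullHom_map (𝟙 M) g gf₁ h₁ h₁'

lemma pullHom_eq_iff (φ ψ : (pull 𝒜 f₁).obj M₁ ⟶ (pull 𝒜 f₂).obj M₂) (g : Y' ⟶ Y)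
    (gf₁ : Y' ⟶ X₁) (gf₂ : Y' ⟶ X₂) (h₁ : g ≫ f₁ = gf₁) (h₂ : g ≫ f₂ = gf₂) :
    pullHom φ g gf₁ gf₂ h₁ h₂ = pullHom ψ g gf₁ gf₂ h₁ h₂ ↔
      (pull 𝒜 g).map φ = (pull 𝒜 g).map ψ := by
  refine ⟨fun h ↦ ?_, fun h ↦ ?_⟩
  · rw [map_eq_pullHom _ _ _ _ h₁ h₂, h, ← map_eq_pullHom _ _ _ _ h₁ h₂]
  · simp only [pullHom, pull] at h ⊢
    rw [h]

/-- The isomorphism `𝟙^* M ≅ M`. -/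
def pullId (M : fibre 𝒜 Y) : (pull 𝒜 (𝟙 Y)).obj M ≅ M :=
  (Cat.Hom.toNatIso (𝒜.mapId (.mk (op Y)))).app M

/-- The isomorphism `g^* f^* M ≅ (g ≫ f)^* M`. -/
def pullComp (g : Y' ⟶ Y) (f₁ : Y ⟶ X₁) (gf₁ : Y' ⟶ X₁) (h : g ≫ f₁ = gf₁) (M : fibre 𝒜 X₁) :
    (pull 𝒜 g).obj ((pull 𝒜 f₁).obj M) ≅ (pull 𝒜 gf₁).obj M :=
  (Cat.Hom.toNatIso (𝒜.mapComp' f₁.op.toLoc g.op.toLoc gf₁.op.toLoc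
    (by rw [← Quiver.Hom.comp_toLoc, ← op_comp, h]))).symm.app M

/-- `pullHom` only applies when source and target are pullbacks, so a target `N` is replaced by `𝟙^*
N`; this recovers the plain functorial pullback `g^* x`. -/
lemma pullHom_comp_pullId_inv {N : fibre 𝒜 Y} (x : (pull 𝒜 f₁).obj M₁ ⟶ N) (g : Y' ⟶ Y)
    (gf₁ : Y' ⟶ X₁) (h₁ : g ≫ f₁ = gf₁) (h₂ : g ≫ 𝟙 Y = g) :
    pullHom (x ≫ (pullId N).inv) g gf₁ g h₁ h₂ =
      (pullComp g f₁ gf₁ h₁ M₁).inv ≫ (pull 𝒜 g).map x := by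
  simp [pullHom, pullId, pullComp, mapComp'_id_comp_inv_app, ← Functor.map_comp]

lemma pullHom_eq (φ : (pull 𝒜 f₁).obj M₁ ⟶ (pull 𝒜 f₂).obj M₂) (g : Y' ⟶ Y)
    (gf₁ : Y' ⟶ X₁) (gf₂ : Y' ⟶ X₂) (h₁ : g ≫ f₁ = gf₁) (h₂ : g ≫ f₂ = gf₂) :
    pullHom φ g gf₁ gf₂ h₁ h₂ = (pullComp g f₁ gf₁ h₁ M₁).inv ≫ (pull 𝒜 g).map φ ≫
      (pullComp g f₂ gf₂ h₂ M₂).hom := rfl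

end

section

variable {X₁ X₂ Y Y' : C} {M₁ : fibre 𝒜 X₁} {M₂ : fibre 𝒜 X₂}
  {f₁ : Y ⟶ X₁} {f₂ : Y ⟶ X₂}
  [∀ S : C, Preadditive (fibre 𝒜 S)] [∀ {T S : C} (f : T ⟶ S), (pull 𝒜 f).Additive]

variable (M₁ M₂ f₁ f₂) in
/-- The operation `pullHom`, as a morphism of groups. -/
def pullHomAddHom (g : Y' ⟶ Y)
    (gf₁ : Y' ⟶ X₁) (gf₂ : Y' ⟶ X₂) (h₁ : g ≫ f₁ = gf₁) (h₂ : g ≫ f₂ = gf₂) :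
    ((pull 𝒜 f₁).obj M₁ ⟶ (pull 𝒜 f₂).obj M₂) →+
      ((pull 𝒜 gf₁).obj M₁ ⟶ (pull 𝒜 gf₂).obj M₂) :=
  AddMonoidHom.mk' (fun φ ↦ pullHom φ g gf₁ gf₂ h₁ h₂) (fun φ ψ ↦ by
    simp only [pullHom_eq]
    rw [Functor.map_add, Preadditive.add_comp, Preadditive.comp_add])

lemma pullHom_sum {ι : Type*} (s : Finset ι)
    (φ : ι → ((pull 𝒜 f₁).obj M₁ ⟶ (pull 𝒜 f₂).obj M₂)) (g : Y' ⟶ Y)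
    (gf₁ : Y' ⟶ X₁) (gf₂ : Y' ⟶ X₂) (h₁ : g ≫ f₁ = gf₁) (h₂ : g ≫ f₂ = gf₂) :
    pullHom (∑ i ∈ s, φ i) g gf₁ gf₂ h₁ h₂ = ∑ i ∈ s, pullHom (φ i) g gf₁ gf₂ h₁ h₂ :=
  map_sum (pullHomAddHom M₁ M₂ f₁ f₂ g gf₁ gf₂ h₁ h₂) φ s

lemma pullHom_zero (g : Y' ⟶ Y)
    (gf₁ : Y' ⟶ X₁) (gf₂ : Y' ⟶ X₂) (h₁ : g ≫ f₁ = gf₁) (h₂ : g ≫ f₂ = gf₂) :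
    pullHom (0 : (pull 𝒜 f₁).obj M₁ ⟶ (pull 𝒜 f₂).obj M₂) g gf₁ gf₂ h₁ h₂ = 0 :=
  map_zero (pullHomAddHom M₁ M₂ f₁ f₂ g gf₁ gf₂ h₁ h₂)

end

end

end BPi

/-! ### Gluing of morphisms and Galois descent data -/

namespace BPi

@[simp]
lemma gal_left_comp {C : Type u} [Category.{v} C] {T S : C} {f : T ⟶ S} (g : Gal f) :
    g.hom.left ≫ f = f := Over.w g.hom

open Pseudofunctor Pseudofunctor.LocallyDiscreteOpToCat

section

variable {C : Type u} [Category.{v} C] {𝒜 : LocallyDiscrete Cᵒᵖ ⥤ᵖ Cat.{v', u'}}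
  {X₁ X₂ : C} {M₁ : fibre 𝒜 X₁} {M₂ : fibre 𝒜 X₂}
  {ι : Type} [Finite ι] {X : ι → C} {Y : C} {c : ∀ i, X i ⟶ Y}
  {f₁ : Y ⟶ X₁} {f₂ : Y ⟶ X₂}

lemma CommutesWithCoproducts.hom_ext (h𝒜 : CommutesWithCoproducts 𝒜)
    (hc : Nonempty (IsColimit (Cofan.mk Y c))) {φ ψ : (pull 𝒜 f₁).obj M₁ ⟶ (pull 𝒜 f₂).obj M₂}
    (h : ∀ i, pullHom φ (c i) (c i ≫ f₁) (c i ≫ f₂) rfl rfl =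
      pullHom ψ (c i) (c i ≫ f₁) (c i ≫ f₂) rfl rfl) : φ = ψ := by
  have := h𝒜 X (Cofan.mk Y c) hc
  refine (Functor.pi' fun i ↦ pull 𝒜 ((Cofan.mk Y c).inj i)).map_injective ?_
  ext i
  exact (pullHom_eq_iff _ _ _ _ _ _ _).1 (h i)

lemma CommutesWithCoproducts.exists_pullHom_eq (h𝒜 : CommutesWithCoproducts 𝒜)
    (hc : Nonempty (IsColimit (Cofan.mk Y c)))
    (x : ∀ i, (pull 𝒜 (c i ≫ f₁)).obj M₁ ⟶ (pull 𝒜 (c i ≫ f₂)).obj M₂) :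
    ∃ φ : (pull 𝒜 f₁).obj M₁ ⟶ (pull 𝒜 f₂).obj M₂, ∀ i,
      pullHom φ (c i) (c i ≫ f₁) (c i ≫ f₂) rfl rfl = x i := by
  have := h𝒜 X (Cofan.mk Y c) hc
  obtain ⟨φ, hφ⟩ := (Functor.pi' fun i ↦ pull 𝒜 ((Cofan.mk Y c).inj i)).map_surjective
    (X := (pull 𝒜 f₁).obj M₁) (Y := (pull 𝒜 f₂).obj M₂) (fun i ↦
      (pullComp (c i) f₁ _ rfl M₁).hom ≫ x i ≫ (pullComp (c i) f₂ _ rfl M₂).inv)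
  refine ⟨φ, fun i ↦ ?_⟩
  have : (pull 𝒜 (c i)).map φ =
      (pullComp (c i) f₁ _ rfl M₁).hom ≫ x i ≫ (pullComp (c i) f₂ _ rfl M₂).inv := congr_fun hφ i
  rw [pullHom_eq, this]
  simp
  rfl

end

section

variable {G : Type u} [Group G] [TopologicalSpace G] [IsTopologicalGroup G]
  {𝒜 : LocallyDiscrete (FinContSet G)ᵒᵖ ⥤ᵖ Cat.{v', u'}}

section

variable {X₁ X₂ Y : FinContSet G}
  {M₁ : fibre 𝒜 X₁} {M₂ : fibre 𝒜 X₂} {f₁ : Y ⟶ X₁} {f₂ : Y ⟶ X₂}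

lemma CommutesWithCoproducts.hom_ext_of_isEmpty (h𝒜 : CommutesWithCoproducts 𝒜) [IsEmpty Y.obj.V]
    (φ ψ : (pull 𝒜 f₁).obj M₁ ⟶ (pull 𝒜 f₂).obj M₂) : φ = ψ :=
  h𝒜.hom_ext (FinContSet.isColimit_of_isEmpty Y (fun _ ↦ Y)) (fun i ↦ i.elim)

lemma CommutesWithCoproducts.hom_ext_of_isTransitive (h𝒜 : CommutesWithCoproducts 𝒜)
    {φ ψ : (pull 𝒜 f₁).obj M₁ ⟶ (pull 𝒜 f₂).obj M₂}
    (h : ∀ ⦃Z : FinContSet G⦄ (_ : IsTransitive Z) (a : Z ⟶ Y),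
      pullHom φ a (a ≫ f₁) (a ≫ f₂) rfl rfl =
      pullHom ψ a (a ≫ f₁) (a ≫ f₂) rfl rfl) : φ = ψ := by
  obtain ⟨ι, _, X, c, hc, hX⟩ := FinContSet.exists_isTransitive_cofan Y
  exact h𝒜.hom_ext hc fun i ↦ h (hX i) (c i)

/-- Only the values of `x` on the orbits of `Y` are used for the construction; every connected set
over `Y` factors through an orbit, and compatibility gives the other values. -/
lemma CommutesWithCoproducts.exists_pullHom_eq_of_isTransitive (h𝒜 : CommutesWithCoproducts 𝒜)
    (x : ∀ ⦃Z : FinContSet G⦄ (_ : IsTransitive Z) (a : Z ⟶ Y),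
      (pull 𝒜 (a ≫ f₁)).obj M₁ ⟶ (pull 𝒜 (a ≫ f₂)).obj M₂)
    (hx : ∀ ⦃Z Z' : FinContSet G⦄ (hZ : IsTransitive Z) (hZ' : IsTransitive Z') (a : Z ⟶ Y)
      (b : Z' ⟶ Z), pullHom (x hZ a) b ((b ≫ a) ≫ f₁) ((b ≫ a) ≫ f₂) (by simp) (by simp) =
        x hZ' (b ≫ a)) :
    ∃ φ : (pull 𝒜 f₁).obj M₁ ⟶ (pull 𝒜 f₂).obj M₂,
      ∀ ⦃Z : FinContSet G⦄ (hZ : IsTransitive Z) (a : Z ⟶ Y),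
        pullHom φ a (a ≫ f₁) (a ≫ f₂) rfl rfl = x hZ a := by
  obtain ⟨ι, _, X, c, ⟨hc⟩, hX⟩ := FinContSet.exists_isTransitive_cofan Y
  obtain ⟨φ, hφ⟩ := h𝒜.exists_pullHom_eq ⟨hc⟩ (fun i ↦ x (hX i) (c i))
  refine ⟨φ, fun Z hZ a ↦ ?_⟩
  obtain ⟨i, b, rfl⟩ := FinContSet.exists_lift_of_isTransitive hc hZ a
  change pullHom φ (b ≫ c i) ((b ≫ c i) ≫ f₁) ((b ≫ c i) ≫ f₂) rfl rfl = x hZ (b ≫ c i)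
  rw [← hx (hX i) hZ (c i) b, ← hφ, pullHom_pullHom]

end

/-! ### Descent data along a Galois covering as Γ-equivariant objects -/

section

variable {T S : FinContSet G} {f : T ⟶ S}

/-- In order to verify that a morphism is compatible with descent data relative
to a Galois covering, it suffices to check the compatibility for the elements of
the Galois group. -/
lemma CommutesWithCoproducts.exists_descentData_hom
    (h𝒜 : CommutesWithCoproducts 𝒜) (hf : IsGaloisCovering f)
    {D₁ D₂ : 𝒜.DescentData (fun _ : Unit ↦ f)} (α : D₁.obj () ⟶ D₂.obj ())
    (hα : ∀ g : Gal f,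
      (pull 𝒜 g.hom.left).map α ≫
        D₂.hom f (i₁ := ()) (i₂ := ()) g.hom.left (𝟙 T) (by simp) (by simp) =
      D₁.hom f (i₁ := ()) (i₂ := ()) g.hom.left (𝟙 T) (by simp) (by simp) ≫
        (pull 𝒜 (𝟙 T)).map α) :
    ∃ φ : D₁ ⟶ D₂, φ.hom () = α := by
  refine ⟨{ hom := fun _ ↦ α, comm := fun Y q _ _ f₁ f₂ hf₁ hf₂ ↦ ?_ }, rfl⟩
  refine h𝒜.hom_ext_of_isTransitive fun Z hZ a ↦ ?_
  -- On a connected test object the pair of maps is the pair (`g`, identity) pulled back along `a ≫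
  -- f₂`, so the condition is a pullback of `hα g`.
  obtain ⟨g, hg⟩ := FinContSet.exists_gal hf hZ (a ≫ f₂) (a ≫ f₁) (by simp [hf₁, hf₂])
  have := congr(pullHom $(hα g) (a ≫ f₂) (a ≫ f₁) (a ≫ f₂) hg (by simp))
  rw [pullHom_comp _ _ _ _ (a ≫ f₁) _ hg hg (by simp),
    pullHom_comp _ _ _ _ (a ≫ f₂) _ hg (by simp) (by simp), pullHom_map, pullHom_map,
    D₁.pullHom_hom _ f (a ≫ q) (by simp [hf₂]) _ _ (by simp) (by simp) _ _ hg (by simp),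
    D₂.pullHom_hom _ f (a ≫ q) (by simp [hf₂]) _ _ (by simp) (by simp) _ _ hg (by simp)] at this
  rw [pullHom_comp _ _ _ _ (a ≫ f₁) _ rfl rfl rfl,
    pullHom_comp _ _ _ _ (a ≫ f₂) _ rfl rfl rfl, pullHom_map, pullHom_map,
    D₁.pullHom_hom a q (a ≫ q) rfl _ _ hf₁ hf₂ _ _ rfl rfl,
    D₂.pullHom_hom a q (a ≫ q) rfl _ _ hf₁ hf₂ _ _ rfl rfl]
  exact this

variable (𝒜 f) in
/-- A descent datum relative to `f : T ⟶ S` which is only defined for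
the action of the Galois group on `T`. -/
structure GaloisDatum where
  obj : fibre 𝒜 T
  hom (g h : Gal f) : (pull 𝒜 g.hom.left).obj obj ⟶ (pull 𝒜 h.hom.left).obj obj
  hom_self (g : Gal f) : hom g g = 𝟙 _
  hom_comp (g h k : Gal f) : hom g h ≫ hom h k = hom g k
  pullHom_hom (g h k : Gal f) :
    pullHom (hom g h) k.hom.left (g * k).hom.left (h * k).hom.left rfl rfl = hom (g * k) (h * k)

namespace GaloisDatum

variable (D : GaloisDatum 𝒜 f)

/-- Writing the pair `(a₁, a₂)` through another map `b'` multiplies `g` and `h` on the right by one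
common element `k`, and the datum is compatible with such translations. -/
lemma pullHom_hom_congr (hf : IsGaloisCovering f) {Z : FinContSet G} (hZ : IsTransitive Z)
    (b b' : Z ⟶ T) (g h g' h' : Gal f) {a₁ a₂ : Z ⟶ T}
    (hg : b ≫ g.hom.left = a₁) (hh : b ≫ h.hom.left = a₂)
    (hg' : b' ≫ g'.hom.left = a₁) (hh' : b' ≫ h'.hom.left = a₂) :
    pullHom (D.hom g h) b a₁ a₂ hg hh = pullHom (D.hom g' h') b' a₁ a₂ hg' hh' := by
  obtain ⟨k, rfl⟩ := FinContSet.exists_gal hf hZ b' b (by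
    have h₁ := hg =≫ f
    have h₂ := hg' =≫ f
    simp only [Category.assoc, gal_left_comp] at h₁ h₂
    rw [h₁, h₂])
  obtain rfl : g * k = g' := FinContSet.gal_ext hf hZ (f₁ := b') (by
    rw [hg', ← hg, Category.assoc]; rfl)
  obtain rfl : h * k = h' := FinContSet.gal_ext hf hZ (f₁ := b') (by
    rw [hh', ← hh, Category.assoc]; rfl)
  rw [← D.pullHom_hom, pullHom_pullHom]

variable (h𝒜 : CommutesWithCoproducts 𝒜) (hf : IsGaloisCovering f)

section

variable {Y : FinContSet G} {q : Y ⟶ S} {f₁ f₂ f₃ : Y ⟶ T} (hf₁ : f₁ ≫ f = q) (hf₂ : f₂ ≫ f = q)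
  (hf₃ : f₃ ≫ f = q)

-- On a connected `Z` the value is forced by the Galois elements relating the two maps to `T`.
-- Taking `b = a ≫ f₁` and `g = 1` supplies one choice, and `pullHom_hom_congr` gives both
-- independence and compatibility.
include h𝒜 hf hf₁ hf₂ in
lemma exists_descentHom :
    ∃ χ : (pull 𝒜 f₁).obj D.obj ⟶ (pull 𝒜 f₂).obj D.obj,
      ∀ ⦃Z : FinContSet G⦄ (_ : IsTransitive Z) (a : Z ⟶ Y) (b : Z ⟶ T) (g h : Gal f)
        (hg : b ≫ g.hom.left = a ≫ f₁) (hh : b ≫ h.hom.left = a ≫ f₂),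
        pullHom χ a (a ≫ f₁) (a ≫ f₂) rfl rfl =
          pullHom (D.hom g h) b (a ≫ f₁) (a ≫ f₂) hg hh := by
  have H ⦃Z : FinContSet G⦄ (hZ : IsTransitive Z) (a : Z ⟶ Y) :
      ∃ g : Gal f, (a ≫ f₁) ≫ g.hom.left = a ≫ f₂ :=
    FinContSet.exists_gal hf hZ _ _ (by simp [hf₁, hf₂])
  choose γ hγ using H
  obtain ⟨χ, hχ⟩ := h𝒜.exists_pullHom_eq_of_isTransitive (f₁ := f₁) (f₂ := f₂) (M₁ := D.obj)
    (M₂ := D.obj) (fun Z hZ a ↦ pullHom (D.hom 1 (γ hZ a)) (a ≫ f₁) (a ≫ f₁) (a ≫ f₂)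
      (Category.comp_id _) (hγ hZ a)) (fun Z Z' hZ hZ' a b ↦ by
        rw [pullHom_pullHom]
        exact D.pullHom_hom_congr hf hZ' _ _ _ _ _ _ _ _ _ _)
  refine ⟨χ, fun Z hZ a b g h hg hh ↦ ?_⟩
  rw [hχ hZ]
  exact D.pullHom_hom_congr hf hZ _ _ _ _ _ _ _ _ _ _

/-- The isomorphisms in the descent datum attached to a Galois datum. -/
noncomputable def descentHom : (pull 𝒜 f₁).obj D.obj ⟶ (pull 𝒜 f₂).obj D.obj :=
  (D.exists_descentHom h𝒜 hf hf₁ hf₂).choose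

lemma pullHom_descentHom {Z : FinContSet G} (hZ : IsTransitive Z) (a : Z ⟶ Y) (b : Z ⟶ T)
    (g h : Gal f) {a₁ a₂ : Z ⟶ T} (ha₁ : a ≫ f₁ = a₁) (ha₂ : a ≫ f₂ = a₂)
    (hg : b ≫ g.hom.left = a₁) (hh : b ≫ h.hom.left = a₂) :
    pullHom (D.descentHom h𝒜 hf hf₁ hf₂) a a₁ a₂ ha₁ ha₂ =
      pullHom (D.hom g h) b a₁ a₂ hg hh := by
  subst ha₁ ha₂
  exact (D.exists_descentHom h𝒜 hf hf₁ hf₂).choose_spec hZ a b g h hg hh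

end

/-- The descent datum attached to a Galois datum. -/
noncomputable def descentData : 𝒜.DescentData (fun _ : Unit ↦ f) where
  obj _ := D.obj
  hom Y q _ _ f₁ f₂ hf₁ hf₂ := D.descentHom h𝒜 hf hf₁ hf₂
  pullHom_hom Y' Y p q q' hq _ _ f₁ f₂ hf₁ hf₂ gf₁ gf₂ hgf₁ hgf₂ := by
    subst hq hgf₁ hgf₂
    refine h𝒜.hom_ext_of_isTransitive fun Z hZ a ↦ ?_
    obtain ⟨g, hg⟩ := FinContSet.exists_gal hf hZ (a ≫ p ≫ f₁) (a ≫ p ≫ f₂)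
      (by simp [hf₁, hf₂])
    rw [pullHom_pullHom, D.pullHom_descentHom h𝒜 hf hf₁ hf₂ hZ (a ≫ p) (a ≫ p ≫ f₁) 1 g
      (by simp) (by simp) (Category.comp_id _) hg, D.pullHom_descentHom h𝒜 hf _ _ hZ a
      (a ≫ p ≫ f₁) 1 g]
  hom_self Y q _ f₁ hf₁ := by
    refine h𝒜.hom_ext_of_isTransitive fun Z hZ a ↦ ?_
    rw [D.pullHom_descentHom h𝒜 hf _ _ hZ a (a ≫ f₁) 1 1 rfl rfl (Category.comp_id _)
      (Category.comp_id _), D.hom_self, pullHom_id_hom, pullHom_id_hom]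
  hom_comp Y q _ _ _ f₁ f₂ f₃ hf₁ hf₂ hf₃ := by
    refine h𝒜.hom_ext_of_isTransitive fun Z hZ a ↦ ?_
    obtain ⟨g, hg⟩ := FinContSet.exists_gal hf hZ (a ≫ f₁) (a ≫ f₂) (by simp [hf₁, hf₂])
    obtain ⟨h, hh⟩ := FinContSet.exists_gal hf hZ (a ≫ f₁) (a ≫ f₃) (by simp [hf₁, hf₃])
    rw [pullHom_comp _ _ _ _ (a ≫ f₂) _ rfl rfl rfl,
      D.pullHom_descentHom h𝒜 hf _ _ hZ a (a ≫ f₁) 1 g rfl rfl (Category.comp_id _) hg,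
      D.pullHom_descentHom h𝒜 hf _ _ hZ a (a ≫ f₁) g h rfl rfl hg hh,
      D.pullHom_descentHom h𝒜 hf _ _ hZ a (a ≫ f₁) 1 h rfl rfl (Category.comp_id _) hh,
      ← pullHom_comp, D.hom_comp]

lemma descentData_hom (g h : Gal f) (hg : g.hom.left ≫ f = f) (hh : h.hom.left ≫ f = f) :
    (D.descentData h𝒜 hf).hom f (i₁ := ()) (i₂ := ()) g.hom.left h.hom.left hg hh =
      D.hom g h := by
  refine h𝒜.hom_ext_of_isTransitive fun Z hZ a ↦ ?_
  exact D.pullHom_descentHom h𝒜 hf hg hh hZ a a g h _ _ _ _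

end GaloisDatum

end

end

end BPi

/-! ### Descent along Cartesian functors with a trace structure -/

namespace BPi

open Pseudofunctor Pseudofunctor.LocallyDiscreteOpToCat

lemma map_unit_comp_map_comp_counit {D : Type u'} [Category.{v'} D] {E : Type u} [Category.{v} E]
    {F : D ⥤ E} {R : E ⥤ D} (adj : F ⊣ R) {A : D} {B : E} (x : F.obj A ⟶ B) :
    F.map (adj.unit.app A) ≫ F.map (R.map x) ≫ adj.counit.app B = x := by
  simp

lemma biproduct_total {D : Type u'} [Category.{v'} D] [Preadditive D] {J : Type u} [Fintype J]
    (X : J → D) [HasBiproduct X] : ∑ j, biproduct.π X j ≫ biproduct.ι X j = 𝟙 (⨁ X) :=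
  IsBilimit.total (biproduct.isBilimit _)

lemma biproduct_desc_eq_sum {D : Type u'} [Category.{v'} D] [Preadditive D] {J : Type u} [Fintype J]
    {X : J → D} [HasBiproduct X] {Y : D} (x : ∀ j, X j ⟶ Y) :
    biproduct.desc x = ∑ j, biproduct.π X j ≫ x j := by
  rw [← Category.id_comp (biproduct.desc x), ← biproduct_total, Preadditive.sum_comp]
  simp only [Category.assoc, biproduct.ι_desc]

section

variable {C : Type u} [Category.{v} C] {𝒜 : LocallyDiscrete Cᵒᵖ ⥤ᵖ Cat.{v', u'}}
  {T S : C} {f : T ⟶ S} {R : fibre 𝒜 T ⥤ fibre 𝒜 S} (adj : pull 𝒜 f ⊣ R)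

/-- The components of `cartesianMap`. -/
def galCounit (M : fibre 𝒜 T) (g : Gal f) :
    (pull 𝒜 f).obj (R.obj M) ⟶ (pull 𝒜 g.hom.left).obj M :=
  pullHom (adj.counit.app M ≫ (pullId M).inv) g.hom.left f g.hom.left (by simp)
    (Category.comp_id _)

lemma pullHom_galCounit (M : fibre 𝒜 T) (g k : Gal f) (h₁ : k.hom.left ≫ f = f)
    (h₂ : k.hom.left ≫ g.hom.left = (g * k).hom.left) :
    pullHom (galCounit adj M g) k.hom.left f (g * k).hom.left h₁ h₂ = galCounit adj M (g * k) := by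
  rw [galCounit, pullHom_pullHom]
  rfl

variable [∀ S : C, Preadditive (fibre 𝒜 S)] [∀ S : C, HasFiniteBiproducts (fibre 𝒜 S)]

section

variable [Finite (Gal f)]

lemma cartesianMap_π (M : fibre 𝒜 T) (g : Gal f) :
    cartesianMap adj M ≫ biproduct.π _ g = galCounit adj M g := by
  rw [galCounit, pullHom_comp_pullId_inv, cartesianMap, biproduct.lift_π]
  rfl

lemma cartesianMapPull_π (A : fibre 𝒜 S) (g : Gal f) :
    cartesianMapPull adj A ≫ biproduct.π _ g =
      pullHom (adj.counit.app ((pull 𝒜 f).obj A)) g.hom.left f f (by simp) (by simp) := by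
  rw [cartesianMapPull, Category.assoc, biproduct.map_π, cartesianMap, biproduct.lift_π_assoc,
    pullHom_eq, Category.assoc]
  rfl

end

section

variable [Fintype (Gal f)]

-- The second trace axiom in usable form: `f^*` of the trace is the sum of the Γ-conjugates of the
-- counit.
variable {adj} in
lemma TraceStructure.map_tr_eq_sum (τ : TraceStructure adj) (A : fibre 𝒜 S) :
    (pull 𝒜 f).map (τ.tr.app A) =
      ∑ g : Gal f, pullHom (adj.counit.app ((pull 𝒜 f).obj A)) g.hom.left f f
        (by simp) (by simp) := by
  rw [τ.map_tr, biproduct_desc_eq_sum, Preadditive.comp_sum]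
  simp only [Category.comp_id]
  exact Finset.sum_congr rfl fun g _ ↦ cartesianMapPull_π adj A g

variable {adj} in
lemma TraceStructure.unit_comp_map_comp_tr (τ : TraceStructure adj) {A B : fibre 𝒜 S} (h : A ⟶ B) :
    adj.unit.app A ≫ R.map ((pull 𝒜 f).map h) ≫ τ.tr.app B = Nat.card (Gal f) • h := by
  rw [← Functor.comp_map, τ.tr.naturality, ← Category.assoc, τ.unit_tr]
  simp

variable (hn : ∀ A : fibre 𝒜 S, ∃ c : A ⟶ A, Nat.card (Gal f) • c = 𝟙 A)

include hn in
lemma nsmul_card_cancel {A B : fibre 𝒜 S} {x y : A ⟶ B}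
    (h : Nat.card (Gal f) • x = Nat.card (Gal f) • y) : x = y := by
  obtain ⟨c, hc⟩ := hn A
  rw [← Category.id_comp x, ← Category.id_comp y, ← hc, Preadditive.nsmul_comp,
    Preadditive.nsmul_comp, ← Preadditive.comp_nsmul, h, Preadditive.comp_nsmul]

variable {adj}

-- The trace recovers `|Γ| • h` from `f^* h`, and `|Γ|` is invertible by `hn`.
include hn in
lemma TraceStructure.faithful_pull (τ : TraceStructure adj) : (pull 𝒜 f).Faithful where
  map_injective {A B x y} h := by
    refine nsmul_card_cancel hn ?_
    rw [← τ.unit_comp_map_comp_tr, ← τ.unit_comp_map_comp_tr, h]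

variable [∀ {T S : C} (f : T ⟶ S), (pull 𝒜 f).Additive]

-- Averaging: `f^*` turns `tr ∘ f_* x ∘ η` into the sum of the conjugates of `x`, all equal to `x`;
-- the endomorphism `c` divides by `|Γ|`.
include hn in
lemma TraceStructure.exists_map_eq (τ : TraceStructure adj) {A B : fibre 𝒜 S}
    (x : (pull 𝒜 f).obj A ⟶ (pull 𝒜 f).obj B)
    (hx : ∀ g : Gal f, pullHom x g.hom.left f f (by simp) (by simp) = x) :
    ∃ y : A ⟶ B, (pull 𝒜 f).map y = x := by
  obtain ⟨c, hc⟩ := hn A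
  have h : (pull 𝒜 f).map (adj.unit.app A ≫ R.map x ≫ τ.tr.app B) = Nat.card (Gal f) • x := by
    rw [Functor.map_comp, Functor.map_comp, τ.map_tr_eq_sum, Preadditive.comp_sum,
      Preadditive.comp_sum]
    have (g : Gal f) : (pull 𝒜 f).map (adj.unit.app A) ≫ (pull 𝒜 f).map (R.map x) ≫
        pullHom (adj.counit.app ((pull 𝒜 f).obj B)) g.hom.left f f (by simp) (by simp) = x := by
      have h₀ : (pull 𝒜 f).map (adj.unit.app A) ≫ (pull 𝒜 f).map (R.map x) ≫
          adj.counit.app ((pull 𝒜 f).obj B) = x :=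
        map_unit_comp_map_comp_counit adj x
      have := congr(pullHom $h₀ g.hom.left f f (gal_left_comp g) (gal_left_comp g))
      rwa [pullHom_comp _ _ _ _ f _ (by simp) (by simp) (by simp),
        pullHom_comp _ _ _ _ f _ (by simp) (by simp) (by simp), pullHom_map, pullHom_map,
        hx] at this
    simp only [this]
    simp
  refine ⟨c ≫ adj.unit.app A ≫ R.map x ≫ τ.tr.app B, ?_⟩
  rw [Functor.map_comp, h, Preadditive.comp_nsmul, ← Preadditive.nsmul_comp,
    ← Functor.map_nsmul, hc, CategoryTheory.Functor.map_id, Category.id_comp]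

end

end

end BPi

/-! ### Effectiveness of descent data relative to a Galois covering -/

namespace BPi

open Pseudofunctor Pseudofunctor.LocallyDiscreteOpToCat

section

variable {C : Type u} [Category.{v} C] {𝒜 : LocallyDiscrete Cᵒᵖ ⥤ᵖ Cat.{v', u'}}

lemma pullHom_eq_pullHom_iff {X₁ X₂ Y S : C} {a₁ : X₁ ⟶ S} {a₂ : X₂ ⟶ S} {f₁ : Y ⟶ X₁}
    {f₂ : Y ⟶ X₂} {q : Y ⟶ S} (h₁ : f₁ ≫ a₁ = q) (h₂ : f₂ ≫ a₂ = q) {A B : fibre 𝒜 S}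
    (x₁ : (pull 𝒜 a₁).obj A ⟶ (pull 𝒜 a₁).obj B) (x₂ : (pull 𝒜 a₂).obj A ⟶ (pull 𝒜 a₂).obj B) :
    pullHom x₁ f₁ q q h₁ h₁ = pullHom x₂ f₂ q q h₂ h₂ ↔
      (pull 𝒜 f₁).map x₁ ≫ (pullComp f₁ a₁ q h₁ B).hom ≫ (pullComp f₂ a₂ q h₂ B).inv =
      ((pullComp f₁ a₁ q h₁ A).hom ≫ (pullComp f₂ a₂ q h₂ A).inv) ≫ (pull 𝒜 f₂).map x₂ := by
  rw [pullHom_eq, pullHom_eq, Iso.inv_comp_eq, ← Category.assoc, ← Category.assoc, Category.assoc,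
    ← Category.assoc, ← Category.assoc, ← Iso.comp_inv_eq]

variable (𝒜) in
/-- The morphisms between the descent data attached to two objects identify to
compatible families of morphisms between their pullbacks. -/
lemma exists_toDescentData_obj_hom_iff {ι : Type*} {S : C} {X : ι → C} (f : ∀ i, X i ⟶ S)
    {A B : fibre 𝒜 S} (x : ∀ i, (pull 𝒜 (f i)).obj A ⟶ (pull 𝒜 (f i)).obj B) :
    (∃ φ : (𝒜.toDescentData f).obj A ⟶ (𝒜.toDescentData f).obj B, φ.hom = x) ↔
      ∀ ⦃Y : C⦄ (q : Y ⟶ S) ⦃i₁ i₂ : ι⦄ (f₁ : Y ⟶ X i₁) (f₂ : Y ⟶ X i₂)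
        (h₁ : f₁ ≫ f i₁ = q) (h₂ : f₂ ≫ f i₂ = q),
        pullHom (x i₁) f₁ q q h₁ h₁ = pullHom (x i₂) f₂ q q h₂ h₂ := by
  refine ⟨?_, fun h ↦ ?_⟩
  · rintro ⟨φ, rfl⟩ Y q i₁ i₂ f₁ f₂ h₁ h₂
    exact (pullHom_eq_pullHom_iff h₁ h₂ _ _).2 (φ.comm q f₁ f₂ h₁ h₂)
  · exact ⟨{ hom := x, comm := fun Y q i₁ i₂ f₁ f₂ h₁ h₂ ↦
      (pullHom_eq_pullHom_iff h₁ h₂ _ _).1 (h q f₁ f₂ h₁ h₂) }, rfl⟩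

end

/-! ### The action of Γ on `f_* M` and its averaging idempotent -/

section

variable {C : Type u} [Category.{v} C] {𝒜 : LocallyDiscrete Cᵒᵖ ⥤ᵖ Cat.{v', u'}}
  {T S : C} {f : T ⟶ S} {R : fibre 𝒜 T ⥤ fibre 𝒜 S} (adj : pull 𝒜 f ⊣ R)
  (D : 𝒜.DescentData (fun _ : Unit ↦ f))

/-- The isomorphisms `g^* M ⟶ h^* M` for `g` and `h` in the Galois group of `f` which
are part of a descent datum. -/
abbrev galHom (g h : Gal f) :
    (pull 𝒜 g.hom.left).obj (D.obj ()) ⟶ (pull 𝒜 h.hom.left).obj (D.obj ()) :=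
  D.hom f (i₁ := ()) (i₂ := ()) g.hom.left h.hom.left (gal_left_comp g) (gal_left_comp h)

lemma pullHom_galHom (g k : Gal f) :
    pullHom (galHom D g 1) k.hom.left (g * k).hom.left k.hom.left rfl (Category.comp_id _) =
      galHom D (g * k) k :=
  D.pullHom_hom k.hom.left f f (gal_left_comp k) _ _ (gal_left_comp g)
    (Category.id_comp f) _ _ rfl (Category.comp_id _)

/-- The composition of the `g`-component of `cartesianMap` and of the isomorphism
`g^* M ⟶ 𝟙^* M` given by a descent datum. -/
def galDescent (g : Gal f) :
    (pull 𝒜 f).obj (R.obj (D.obj ())) ⟶ (pull 𝒜 (𝟙 T)).obj (D.obj ()) :=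
  galCounit adj (D.obj ()) g ≫ galHom D g 1

lemma pullHom_galDescent (g k : Gal f) :
    pullHom (galDescent adj D g) k.hom.left f k.hom.left (by simp) (Category.comp_id _) ≫
      galHom D k 1 = galDescent adj D (g * k) := by
  rw [galDescent, pullHom_comp _ _ _ _ (g * k).hom.left _ (by simp) rfl (Category.comp_id _),
    pullHom_galCounit, galDescent, Category.assoc]
  congr 1
  exact (congrArg (· ≫ galHom D k 1) (pullHom_galHom D g k)).trans (D.hom_comp _ _ _ _ _ _ _)

/-- The endomorphism of `f_* M` corresponding to `galDescent`. -/
def galEnd (g : Gal f) : R.obj (D.obj ()) ⟶ R.obj (D.obj ()) :=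
  adj.unit.app _ ≫ R.map (galDescent adj D g ≫ (pullId _).hom)

/-- In the coordinates `galDescent`, the endomorphism attached to `g` permutes the copies of `M` in
`f^* f_* M` by translation. -/
lemma map_galEnd_galDescent (g k : Gal f) :
    (pull 𝒜 f).map (galEnd adj D g) ≫ galDescent adj D k = galDescent adj D (g * k) := by
  have h₀ : (pull 𝒜 f).map (galEnd adj D g) ≫ adj.counit.app _ ≫ (pullId _).inv =
      galDescent adj D g := by
    rw [galEnd, Functor.map_comp, Category.assoc, ← Category.assoc _ _ (pullId _).inv]
    have := map_unit_comp_map_comp_counit adj (galDescent adj D g ≫ (pullId _).hom)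
    rw [← Category.assoc] at this ⊢
    rw [Category.assoc] at this ⊢
    rw [← Category.assoc, ← Category.assoc, Category.assoc ((pull 𝒜 f).map _), this]
    simp
  have := congr(pullHom $h₀ k.hom.left f k.hom.left (gal_left_comp k) (Category.comp_id _))
  rw [pullHom_comp _ _ _ _ f _ (by simp) (by simp) (Category.comp_id _), pullHom_map] at this
  rw [← pullHom_galDescent, ← this, Category.assoc]
  rfl

variable [∀ S : C, Preadditive (fibre 𝒜 S)] [∀ S : C, HasFiniteBiproducts (fibre 𝒜 S)]
  [Finite (Gal f)]

lemma galCounit_hom_ext {M : fibre 𝒜 T} (hM : IsIso (cartesianMap adj M)) {N : fibre 𝒜 T}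
    {x y : N ⟶ (pull 𝒜 f).obj (R.obj M)}
    (h : ∀ g, x ≫ galCounit adj M g = y ≫ galCounit adj M g) : x = y := by
  rw [← cancel_mono (cartesianMap adj M)]
  refine biproduct.hom_ext _ _ fun g ↦ ?_
  simpa only [Category.assoc, cartesianMap_π] using h g

lemma exists_comp_galCounit {M : fibre 𝒜 T} (hM : IsIso (cartesianMap adj M)) {N : fibre 𝒜 T}
    (x : ∀ g : Gal f, N ⟶ (pull 𝒜 g.hom.left).obj M) :
    ∃ y : N ⟶ (pull 𝒜 f).obj (R.obj M), ∀ g, y ≫ galCounit adj M g = x g :=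
  ⟨biproduct.lift x ≫ inv (cartesianMap adj M), fun g ↦ by simp [← cartesianMap_π]⟩

lemma galDescent_hom_ext (hM : IsIso (cartesianMap adj (D.obj ()))) {N : fibre 𝒜 T}
    {x y : N ⟶ (pull 𝒜 f).obj (R.obj (D.obj ()))}
    (h : ∀ g, x ≫ galDescent adj D g = y ≫ galDescent adj D g) : x = y := by
  refine galCounit_hom_ext adj hM fun g ↦ ?_
  have := h g =≫ galHom D 1 g
  simp only [galDescent, Category.assoc] at this
  rwa [D.hom_comp, D.hom_self, Category.comp_id] at this
  simp

/-- The map `ι` is the diagonal embedding of `M` into the copies of `M` that make up `f^* f_* M`. -/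
lemma exists_comp_galDescent (hM : IsIso (cartesianMap adj (D.obj ()))) :
    ∃ ι : (pull 𝒜 (𝟙 T)).obj (D.obj ()) ⟶ (pull 𝒜 f).obj (R.obj (D.obj ())),
      ∀ g, ι ≫ galDescent adj D g = 𝟙 _ := by
  obtain ⟨ι, hι⟩ := exists_comp_galCounit adj hM (fun g ↦ galHom D 1 g)
  refine ⟨ι, fun g ↦ ?_⟩
  rw [galDescent, ← Category.assoc, hι, D.hom_comp]
  exact D.hom_self _ _ (by simp)

variable {adj} [∀ {T S : C} (f : T ⟶ S), (pull 𝒜 f).Additive]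
  [IsIdempotentComplete (fibre 𝒜 S)]

/-- After `f^*`, the sum `a` of the Galois endomorphisms adds all coordinates (`π`) and embeds the
result diagonally (`ι`). Hence `c ≫ a` is an idempotent whose pullback projects onto the diagonal, a
copy of `M`. The trace serves only through the faithfulness of `f^*`, which brings `a ≫ a = |Γ| • a`
down to `S`. -/
lemma TraceStructure.exists_isIso_of_descentData
    (hn : ∀ A : fibre 𝒜 S, ∃ c : A ⟶ A, Nat.card (Gal f) • c = 𝟙 A) (τ : TraceStructure adj)
    (hM : IsIso (cartesianMap adj (D.obj ()))) :
    ∃ (A : fibre 𝒜 S) (θ : (pull 𝒜 f).obj A ⟶ (pull 𝒜 (𝟙 T)).obj (D.obj ())), IsIso θ ∧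
      ∀ g : Gal f, pullHom θ g.hom.left f g.hom.left (by simp) (Category.comp_id _) ≫
        galHom D g 1 = θ := by
  have := Fintype.ofFinite (Gal f)
  have := τ.faithful_pull hn
  obtain ⟨ι, hι⟩ := exists_comp_galDescent adj D hM
  obtain ⟨c, hc⟩ := hn (R.obj (D.obj ()))
  let a := ∑ g, galEnd adj D g
  let π := ∑ g, galDescent adj D g
  have h₁ (k : Gal f) : (pull 𝒜 f).map a ≫ galDescent adj D k = π := by
    simp only [a, π, Functor.map_sum, Preadditive.sum_comp, map_galEnd_galDescent]
    exact Equiv.sum_comp (Equiv.mulRight k) (galDescent adj D)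
  have h₂ : (pull 𝒜 f).map a = π ≫ ι :=
    galDescent_hom_ext adj D hM fun g ↦ by rw [h₁, Category.assoc, hι, Category.comp_id]
  have h₃ : ι ≫ π = Nat.card (Gal f) • 𝟙 _ := by
    simp [π, Preadditive.comp_sum, hι]
  have h₄ : a ≫ a = Nat.card (Gal f) • a := by
    refine (pull 𝒜 f).map_injective ?_
    rw [Functor.map_comp, Functor.map_nsmul, h₂, Category.assoc, ← Category.assoc ι, h₃]
    simp
  have h₅ (x : R.obj (D.obj ()) ⟶ R.obj (D.obj ())) : c ≫ x = x ≫ c := by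
    refine nsmul_card_cancel hn ?_
    rw [← Preadditive.nsmul_comp, hc, ← Preadditive.comp_nsmul, hc]
    simp
  have h₆ : (c ≫ a) ≫ (c ≫ a) = c ≫ a := by
    rw [Category.assoc, ← Category.assoc a, ← h₅ a, Category.assoc, h₄, Preadditive.comp_nsmul,
      Preadditive.comp_nsmul, ← Preadditive.nsmul_comp, hc, Category.id_comp]
  obtain ⟨A, i, r, hir, hri⟩ := IsIdempotentComplete.idempotents_split _ _ h₆
  have hi : i = i ≫ c ≫ a := by rw [← hri, ← Category.assoc, hir, Category.id_comp]
  -- The image of `f^* i` lies in the diagonal: all its coordinates agree, so any one of them, here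
  -- the one at 1, can serve as `θ`.
  have h₇ (k : Gal f) : (pull 𝒜 f).map i ≫ galDescent adj D k =
      (pull 𝒜 f).map i ≫ galDescent adj D 1 := by
    rw [hi]
    simp only [Functor.map_comp, Category.assoc, h₁]
  refine ⟨A, (pull 𝒜 f).map i ≫ galDescent adj D 1, ⟨ι ≫ (pull 𝒜 f).map r, ?_, ?_⟩, fun g ↦ ?_⟩
  · have : ((pull 𝒜 f).map i ≫ galDescent adj D 1) ≫ ι = (pull 𝒜 f).map i :=
      galDescent_hom_ext adj D hM fun g ↦ by
        rw [Category.assoc, hι, Category.comp_id, h₇ g]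
    rw [← Category.assoc, this, ← Functor.map_comp, hir, CategoryTheory.Functor.map_id]
  · rw [Category.assoc, ← Category.assoc ((pull 𝒜 f).map r), ← Functor.map_comp, hri, h₅,
      Functor.map_comp, h₂]
    simp only [← Category.assoc]
    rw [h₃, Preadditive.nsmul_comp, Preadditive.nsmul_comp, Preadditive.nsmul_comp,
      Category.id_comp, Category.assoc, ← Preadditive.comp_nsmul, ← Preadditive.nsmul_comp,
      ← Functor.map_nsmul, hc, CategoryTheory.Functor.map_id, Category.id_comp, hι]
  · rw [pullHom_comp _ _ _ _ f _ (by simp) (by simp) (Category.comp_id _), pullHom_map,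
      Category.assoc, pullHom_galDescent, one_mul, h₇]

end

section

variable {G : Type u} [Group G] [TopologicalSpace G] [IsTopologicalGroup G]
  {𝒜 : LocallyDiscrete (FinContSet G)ᵒᵖ ⥤ᵖ Cat.{v', u'}} {T S : FinContSet G} {f : T ⟶ S}

/-- This only removes the coherence isomorphisms: equivariance of `θ`, phrased with `𝟙^* M`, becomes
the condition of `exists_descentData_hom`. -/
lemma CommutesWithCoproducts.exists_toDescentData_hom
    (h𝒜 : CommutesWithCoproducts 𝒜) (hf : IsGaloisCovering f)
    {D : 𝒜.DescentData (fun _ : Unit ↦ f)} {A : fibre 𝒜 S}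
    (θ : (pull 𝒜 f).obj A ⟶ (pull 𝒜 (𝟙 T)).obj (D.obj ()))
    (hθ : ∀ g : Gal f, pullHom θ g.hom.left f g.hom.left (by simp) (Category.comp_id _) ≫
        galHom D g 1 = θ) :
    ∃ φ : (𝒜.toDescentData (fun _ : Unit ↦ f)).obj A ⟶ D,
      φ.hom () = θ ≫ (pullId _).hom := by
  refine h𝒜.exists_descentData_hom hf _ fun g ↦ ?_
  have h₁ (k : T ⟶ T) (h : k ≫ f = f) := pullHom_comp_pullId_inv (θ ≫ (pullId _).hom) k f
    h (Category.comp_id _)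
  have h₂ : (θ ≫ (pullId _).hom) ≫ (pullId _).inv = θ := by simp
  simp only [h₂] at h₁
  have h₃ := h₁ g.hom.left (by simp)
  have h₄ := h₁ (𝟙 T) (by simp)
  rw [pullHom_id] at h₄
  have h₅ := hθ g
  rw [h₃, Category.assoc] at h₅
  replace h₅ := h₅.trans h₄
  refine (cancel_epi (pullComp g.hom.left f f (by simp) A).inv).1 (h₅.trans ?_)
  symm
  have h₆ {X₁ X₂ X₃ X₄ : fibre 𝒜 T} (e : X₁ ≅ X₂) (u : X₁ ⟶ X₃) (x : X₃ ⟶ X₄) :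
      e.hom ≫ (e.inv ≫ u) ≫ x = u ≫ x := by simp
  exact h₆ (pullComp g.hom.left f f (by simp) A).symm (pullComp (𝟙 T) f f (by simp) A).inv _

variable [∀ S : FinContSet G, Preadditive (fibre 𝒜 S)]
  [∀ S : FinContSet G, HasFiniteBiproducts (fibre 𝒜 S)]
  [∀ {T S : FinContSet G} (f : T ⟶ S), (pull 𝒜 f).Additive]
  [IsIdempotentComplete (fibre 𝒜 S)]

lemma IsCartesianWithTrace.isEquivalence_toDescentData (h : IsCartesianWithTrace 𝒜 f)
    (hn : ∀ A : fibre 𝒜 S, ∃ c : A ⟶ A, Nat.card (Gal f) • c = 𝟙 A)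
    (h𝒜 : CommutesWithCoproducts 𝒜) (hf : IsGaloisCovering f) :
    (𝒜.toDescentData (fun _ : Unit ↦ f)).IsEquivalence := by
  have := Fintype.ofFinite (Gal f)
  obtain ⟨R, adj, hR, ⟨τ⟩⟩ := h
  have hfaithful := τ.faithful_pull hn
  have : (𝒜.toDescentData (fun _ : Unit ↦ f)).Faithful :=
    ⟨fun {A B x y} hxy ↦ (pull 𝒜 f).map_injective
      (congr_fun (congr_arg DescentData.Hom.hom hxy) ())⟩
  have : (𝒜.toDescentData (fun _ : Unit ↦ f)).Full := by
    refine ⟨fun {A B} φ ↦ ?_⟩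
    suffices ∀ g : Gal f, pullHom (φ.hom ()) g.hom.left f f (by simp) (by simp) = φ.hom () by
      obtain ⟨y, hy⟩ := τ.exists_map_eq hn (φ.hom ()) this
      exact ⟨y, DescentData.hom_ext (fun _ ↦ hy)⟩
    intro g
    have h₁ := (exists_toDescentData_obj_hom_iff 𝒜 (fun _ : Unit ↦ f) φ.hom).1 ⟨φ, rfl⟩ f
      (i₁ := ()) (i₂ := ()) g.hom.left (𝟙 T) (by simp) (by simp)
    exact h₁.trans (pullHom_id (φ.hom ()))
  have : (𝒜.toDescentData (fun _ : Unit ↦ f)).EssSurj := by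
    refine ⟨fun D ↦ ?_⟩
    obtain ⟨A, θ, hθ', hθ⟩ := τ.exists_isIso_of_descentData D hn (hR _)
    obtain ⟨φ, hφ⟩ := h𝒜.exists_toDescentData_hom hf θ hθ
    have (i : Unit) : IsIso (φ.hom i) := by
      obtain rfl : i = () := rfl
      rw [hφ]
      exact IsIso.comp_isIso' (f := θ) (h := (pullId (D.obj ())).hom) inferInstance inferInstance
    exact ⟨A, ⟨DescentData.isoMk (fun i ↦ asIso (φ.hom i)) φ.comm⟩⟩
  exact { }

end

end BPi

/-! ### Descent for families which are disjoint unions of coverings -/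

namespace BPi

open Pseudofunctor Pseudofunctor.LocallyDiscreteOpToCat

section

variable {C : Type u} [Category.{v} C] {𝒜 : LocallyDiscrete Cᵒᵖ ⥤ᵖ Cat.{v', u'}}

lemma pullComp_hom_naturality {X Y Y' : C} (g : Y' ⟶ Y) (f : Y ⟶ X) (gf : Y' ⟶ X) (h : g ≫ f = gf)
    {M N : fibre 𝒜 X} (α : M ⟶ N) :
    (pull 𝒜 g).map ((pull 𝒜 f).map α) ≫ (pullComp g f gf h N).hom =
      (pullComp g f gf h M).hom ≫ (pull 𝒜 gf).map α :=
  (Cat.Hom.toNatIso (𝒜.mapComp' f.op.toLoc g.op.toLoc gf.op.toLoc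
    (by rw [← Quiver.Hom.comp_toLoc, ← op_comp, h]))).symm.hom.naturality α

variable (𝒜) in
instance (Y : C) : (pull 𝒜 (𝟙 Y)).IsEquivalence :=
  Functor.isEquivalence_of_iso (F := 𝟭 _) (Cat.Hom.toNatIso (𝒜.mapId (.mk (op Y)))).symm

lemma map_comp_hom_iff_pullFunctor {ι ι' : Type*} {S S' : C} {X : ι → C} {f : ∀ i, X i ⟶ S}
    {X' : ι' → C} {f' : ∀ i, X' i ⟶ S'} {p : S' ⟶ S} {α : ι' → ι} {p' : ∀ j, X' j ⟶ X (α j)}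
    (w : ∀ j, p' j ≫ f (α j) = f' j ≫ p) {D₁ D₂ : 𝒜.DescentData f} {Y : C} (q : Y ⟶ S') (q' : Y ⟶ S)
    (hq : q ≫ p = q')
    {j₁ j₂ : ι'} (f₁ : Y ⟶ X' j₁) (f₂ : Y ⟶ X' j₂) (g₁ : Y ⟶ X (α j₁)) (g₂ : Y ⟶ X (α j₂))
    (hf₁ : f₁ ≫ f' j₁ = q) (hf₂ : f₂ ≫ f' j₂ = q)
    (hg₁ : f₁ ≫ p' j₁ = g₁) (hg₂ : f₂ ≫ p' j₂ = g₂)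
    (hg₁' : g₁ ≫ f (α j₁) = q') (hg₂' : g₂ ≫ f (α j₂) = q')
    (x₁ : D₁.obj (α j₁) ⟶ D₂.obj (α j₁)) (x₂ : D₁.obj (α j₂) ⟶ D₂.obj (α j₂)) :
    (pull 𝒜 f₁).map ((pull 𝒜 (p' j₁)).map x₁) ≫
      ((DescentData.pullFunctor 𝒜 w).obj D₂).hom q f₁ f₂ hf₁ hf₂ =
    ((DescentData.pullFunctor 𝒜 w).obj D₁).hom q f₁ f₂ hf₁ hf₂ ≫
      (pull 𝒜 f₂).map ((pull 𝒜 (p' j₂)).map x₂) ↔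
    (pull 𝒜 g₁).map x₁ ≫ D₂.hom q' g₁ g₂ hg₁' hg₂' =
      D₁.hom q' g₁ g₂ hg₁' hg₂' ≫ (pull 𝒜 g₂).map x₂ := by
  subst hf₁
  have h₁ (D : 𝒜.DescentData f) :
      ((DescentData.pullFunctor 𝒜 w).obj D).hom (f₁ ≫ f' j₁) f₁ f₂ rfl hf₂ =
      (pullComp f₁ (p' j₁) g₁ hg₁ _).hom ≫ D.hom q' g₁ g₂ hg₁' hg₂' ≫
        (pullComp f₂ (p' j₂) g₂ hg₂ _).inv :=
    DescentData.pullFunctorObjHom_eq w D _ f₁ f₂ q' g₁ g₂ rfl hf₂ hq hg₁ hg₂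
  have h₂ : (pull 𝒜 f₁).map ((pull 𝒜 (p' j₁)).map x₁) ≫
      (pullComp f₁ (p' j₁) g₁ hg₁ _).hom ≫ D₂.hom q' g₁ g₂ hg₁' hg₂' ≫
        (pullComp f₂ (p' j₂) g₂ hg₂ _).inv =
      ((pullComp f₁ (p' j₁) g₁ hg₁ _).hom ≫ D₁.hom q' g₁ g₂ hg₁' hg₂' ≫
        (pullComp f₂ (p' j₂) g₂ hg₂ _).inv) ≫ (pull 𝒜 f₂).map ((pull 𝒜 (p' j₂)).map x₂) ↔
      (pull 𝒜 g₁).map x₁ ≫ D₂.hom q' g₁ g₂ hg₁' hg₂' =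
        D₁.hom q' g₁ g₂ hg₁' hg₂' ≫ (pull 𝒜 g₂).map x₂ := by
    rw [← Category.assoc, pullComp_hom_naturality, Category.assoc, Category.assoc, cancel_epi,
      ← Category.assoc,
      Iso.comp_inv_eq, Category.assoc, Category.assoc, pullComp_hom_naturality,
      Iso.inv_hom_id_assoc]
  rw [h₁ D₁, h₁ D₂]
  exact h₂

end

section

variable {G : Type u} [Group G] [TopologicalSpace G] [IsTopologicalGroup G]
  {𝒜 : LocallyDiscrete (FinContSet G)ᵒᵖ ⥤ᵖ Cat.{v', u'}}

/-- Over `S`, overlaps of distinct `T i` are empty, where all morphisms agree; maps to the same `T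
i` that agree over `S` agree over `X i`. So restricting a descent datum to each `t i` is fully
faithful. -/
lemma CommutesWithCoproducts.isEquivalence_toDescentData (h𝒜 : CommutesWithCoproducts 𝒜)
    {ι : Type} [Finite ι] {S : FinContSet G} {X T : ι → FinContSet G} {c : ∀ i, X i ⟶ S}
    (hc : IsColimit (Cofan.mk S c)) (t : ∀ i, T i ⟶ X i)
    (ht : ∀ i, (𝒜.toDescentData (fun _ : Unit ↦ t i)).IsEquivalence) :
    (𝒜.toDescentData (fun i ↦ t i ≫ c i)).IsEquivalence := by
  let Φ (i : ι) : 𝒜.DescentData (fun i ↦ t i ≫ c i) ⥤ 𝒜.DescentData (fun _ : Unit ↦ t i) :=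
    DescentData.pullFunctor 𝒜 (p := c i) (α := fun _ ↦ i) (p' := fun _ ↦ 𝟙 _) (by simp)
  have : (Functor.pi' Φ).Faithful := ⟨fun {D₁ D₂ φ ψ} h ↦ by
    refine DescentData.hom_ext (fun i ↦ (pull 𝒜 (𝟙 (T i))).map_injective ?_)
    exact congr_fun (congr_arg DescentData.Hom.hom (congr_fun h i)) ()⟩
  have : (Functor.pi' Φ).Full := ⟨fun {D₁ D₂} φ ↦ by
    have h (i : ι) := (pull 𝒜 (𝟙 (T i))).map_surjective (X := D₁.obj i) (Y := D₂.obj i)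
      ((φ i).hom ())
    choose x hx using h
    refine ⟨{ hom := x, comm := fun Y q i j f₁ f₂ hf₁ hf₂ ↦ ?_ }, ?_⟩
    · by_cases hij : i = j
      · subst hij
        have h₁ := FinContSet.mono_inj (c := Cofan.mk S c) hc (i := i)
          (a := f₁ ≫ t i) (b := f₂ ≫ t i) (by
          simp [hf₁, hf₂])
        have h₂ := (φ i).comm _ (i₁ := ()) (i₂ := ()) f₁ f₂ rfl h₁.symm
        rw [← hx] at h₂
        exact (map_comp_hom_iff_pullFunctor (f := fun i ↦ t i ≫ c i) (f' := fun _ : Unit ↦ t i)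
          (p := c i) (α := fun _ ↦ i) (p' := fun _ ↦ 𝟙 (T i)) (by simp) (D₁ := D₁) (D₂ := D₂)
          (f₁ ≫ t i) q (by simpa using hf₁) (j₁ := ()) (j₂ := ()) f₁ f₂ f₁ f₂ rfl h₁.symm
          (Category.comp_id _) (Category.comp_id _) hf₁ hf₂ (x i) (x i)).1 h₂
      · have := FinContSet.isEmpty_of_ne (c := Cofan.mk S c) hc hij (f₁ ≫ t i) (f₂ ≫ t j)
          (by simp [hf₁, hf₂])
        exact h𝒜.hom_ext_of_isEmpty _ _
    · funext i
      exact DescentData.hom_ext fun _ ↦ hx i⟩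
  have := h𝒜 X _ ⟨hc⟩
  -- The composite with the restriction is a product of equivalences after the coproduct
  -- equivalence. Full faithfulness of the restriction then suffices; its essential surjectivity is
  -- not needed.
  let e : 𝒜.toDescentData (fun i ↦ t i ≫ c i) ⋙ Functor.pi' Φ ≅
      (Functor.pi' fun i ↦ pull 𝒜 ((Cofan.mk S c).inj i)) ⋙
        Functor.pi (fun i ↦ 𝒜.toDescentData (fun _ : Unit ↦ t i)) :=
    NatIso.pi' (fun i ↦ DescentData.toDescentDataCompPullFunctorIso 𝒜 _)
  have := Functor.isEquivalence_of_iso e.symm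
  have := Functor.essSurj_of_comp_fully_faithful (𝒜.toDescentData fun i ↦ t i ≫ c i)
    (Functor.pi' Φ)
  have := Functor.Faithful.of_comp (𝒜.toDescentData fun i ↦ t i ≫ c i) (Functor.pi' Φ)
  have := Functor.Full.of_comp_faithful (𝒜.toDescentData fun i ↦ t i ≫ c i) (Functor.pi' Φ)
  exact { }

end

end BPi

/-! ### Cartesian functors with a trace structure give stacks -/

namespace BPi

open Pseudofunctor Pseudofunctor.LocallyDiscreteOpToCat

section

variable {G : Type u} [Group G] [TopologicalSpace G] [IsTopologicalGroup G] [CompactSpace G]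
  {𝒜 : LocallyDiscrete (FinContSet G)ᵒᵖ ⥤ᵖ Cat.{v', u'}}

lemma FinContSet.exists_fac_of_jointly_surjective {N : OpenNormalSubgroup G} {S : FinContSet G}
    {ι : Type*} {T : ι → FinContSet G} {f : ∀ i, T i ⟶ S}
    (hf : ∀ s : S.obj.V, ∃ i x, (f i).hom.hom x = s)
    (hN : ∀ i, N ≤ actionKer (T i)) (a : quot N ⟶ S) : ∃ i b, b ≫ f i = a := by
  obtain ⟨i, x, hx⟩ := hf (a.hom.hom (quotOne N))
  obtain ⟨b, hb⟩ := exists_quot_hom (hN i) x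
  exact ⟨i, b, hom_ext_of_isTransitive (isTransitive_quot N) (quotOne N) (by simp [hb, hx])⟩

/-- `𝒜` satisfies descent for the morphisms from the quotients of `G` by open normal subgroups
to connected `G`-sets. -/
def HasQuotDescent (𝒜 : LocallyDiscrete (FinContSet G)ᵒᵖ ⥤ᵖ Cat.{v', u'}) : Prop :=
  ∀ (N : OpenNormalSubgroup G) (S : FinContSet G) (_ : IsTransitive S) (t : FinContSet.quot N ⟶ S),
    (𝒜.toDescentData (fun _ : Unit ↦ t)).IsEquivalence

lemma HasQuotDescent.faithful (hQ : HasQuotDescent 𝒜) {N : OpenNormalSubgroup G} {S : FinContSet G}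
    (hS : IsTransitive S) (t : FinContSet.quot N ⟶ S) : (pull 𝒜 t).Faithful := by
  have := hQ N S hS t
  exact ⟨fun {A B x y} h ↦ (𝒜.toDescentData (fun _ : Unit ↦ t)).map_injective
    (DescentData.hom_ext fun _ ↦ h)⟩

/-- Any covering sieve contains a covering family for which descent holds. -/
lemma HasQuotDescent.exists_isEquivalence (hQ : HasQuotDescent 𝒜) (h𝒜 : CommutesWithCoproducts 𝒜)
    {S : FinContSet G} {R : Sieve S} (hR : R ∈ naturalTopology G S) :
    ∃ (N : OpenNormalSubgroup G) (ι : Type) (f : ι → (FinContSet.quot N ⟶ S)),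
      (∀ i, R (f i)) ∧ (∀ s, ∃ i x, (f i).hom.hom x = s) ∧ (𝒜.toDescentData f).IsEquivalence := by
  obtain ⟨N, hN, hN'⟩ := FinContSet.exists_openNormalSubgroup_of_mem_naturalTopology hR
  obtain ⟨ι, _, X, c, ⟨hc⟩, hX⟩ := FinContSet.exists_isTransitive_cofan S
  have hb := FinContSet.bijective_of_isColimit hc
  have hNX (i : ι) : N ≤ FinContSet.actionKer (X i) := fun n hn ↦ by
    change n ∈ (MulAction.toPermHom G (X i).obj.V).ker
    rw [MonoidHom.mem_ker]
    ext x
    have : (c i).hom.hom (n • x) = (c i).hom.hom x := by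
      rw [FinContSet.hom_smul]
      exact FinContSet.smul_eq_of_mem_actionKer (hN hn) _
    simpa using hb.1 (a₁ := ⟨i, n • x⟩) (a₂ := ⟨i, x⟩) this
  have (i : ι) : ∃ t : FinContSet.quot N ⟶ X i, True := by
    obtain ⟨x⟩ := (hX i).nonempty
    obtain ⟨t, -⟩ := FinContSet.exists_quot_hom (hNX i) x
    exact ⟨t, trivial⟩
  choose t _ using this
  refine ⟨N, ι, fun i ↦ t i ≫ c i, fun i ↦ hN' _, fun s ↦ ?_,
    h𝒜.isEquivalence_toDescentData hc t fun i ↦ hQ _ _ (hX i) _⟩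
  obtain ⟨⟨i, x⟩, rfl⟩ := hb.2 s
  have := (hX i).isPretransitive
  obtain ⟨g, hg⟩ := MulAction.exists_smul_eq G ((t i).hom.hom (FinContSet.quotOne N)) x
  refine ⟨i, g • FinContSet.quotOne N, ?_⟩
  rw [FinContSet.comp_apply, FinContSet.hom_smul, hg]
  rfl

/-- A compatible family on `R` is restricted to the `f i` and descended there. To compare it with
the family at another `r` in `R`, connected sets over the source of `r` are refined by a quotient of
`G` factoring through some `f i`; pullback along the refinement is faithful. -/
lemma HasQuotDescent.isPrestack (hQ : HasQuotDescent 𝒜) (h𝒜 : CommutesWithCoproducts 𝒜) :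
    𝒜.IsPrestack (naturalTopology G) := by
  refine .of_isPrestackFor fun S R hR ↦ ⟨?_⟩
  obtain ⟨N, ι, f, hfR, hf, _⟩ := hQ.exists_isEquivalence h𝒜 hR
  rw [Functor.FullyFaithful.nonempty_iff_map_bijective]
  refine fun A B ↦ ⟨fun x y h ↦ ?_, fun φ ↦ ?_⟩
  · refine (𝒜.toDescentData f).map_injective (DescentData.hom_ext fun i ↦ ?_)
    exact congr_fun (congr_arg DescentData.Hom.hom h) ⟨Over.mk (f i), hfR i⟩
  · have hφ := (exists_toDescentData_obj_hom_iff 𝒜 (fun f : R.arrows.category ↦ f.obj.hom) φ.hom).1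
      ⟨φ, rfl⟩
    obtain ⟨ψ, hψ⟩ := (exists_toDescentData_obj_hom_iff 𝒜 f (A := A) (B := B)
      (fun i ↦ φ.hom ⟨Over.mk (f i), hfR i⟩)).2 (fun Y q i₁ i₂ f₁ f₂ h₁ h₂ ↦
        hφ q (i₁ := ⟨Over.mk (f i₁), hfR i₁⟩) (i₂ := ⟨Over.mk (f i₂), hfR i₂⟩) f₁ f₂ h₁ h₂)
    obtain ⟨x, hx⟩ := (𝒜.toDescentData f).map_surjective ψ
    have hx' (i : ι) : (pull 𝒜 (f i)).map x = φ.hom ⟨Over.mk (f i), hfR i⟩ := by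
      rw [← congr_fun hψ i, ← hx]
      rfl
    refine ⟨x, DescentData.hom_ext fun ⟨r, hr⟩ ↦ ?_⟩
    suffices ∀ y : (pull 𝒜 r.hom).obj A ⟶ (pull 𝒜 r.hom).obj B, (∀ ⦃Y : FinContSet G⦄ (q : Y ⟶ S) i
        (g : Y ⟶ r.left) (b : Y ⟶ FinContSet.quot N) (h₁ : g ≫ r.hom = q) (h₂ : b ≫ f i = q),
        pullHom y g q q h₁ h₁ = pullHom ((pull 𝒜 (f i)).map x) b q q h₂ h₂) →
        (pull 𝒜 r.hom).map x = y from this (φ.hom ⟨r, hr⟩) (fun Y q i g b h₁ h₂ ↦ by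
          rw [hx' i]
          exact hφ q (i₁ := ⟨r, hr⟩) (i₂ := ⟨Over.mk (f i), hfR i⟩) g b h₁ h₂)
    intro y hy
    refine h𝒜.hom_ext_of_isTransitive fun Z hZ a ↦ ?_
    obtain ⟨z⟩ := hZ.nonempty
    obtain ⟨t, -⟩ := FinContSet.exists_quot_hom
      (inf_le_left : FinContSet.actionKer Z ⊓ N ≤ _) z
    have := hQ.faithful hZ t
    refine (pull 𝒜 t).map_injective ?_
    rw [← pullHom_eq_iff _ _ t (t ≫ a ≫ r.hom) (t ≫ a ≫ r.hom) rfl rfl,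
      pullHom_pullHom, pullHom_pullHom]
    obtain ⟨i, b, hb⟩ := FinContSet.exists_fac_of_jointly_surjective hf
      (fun _ ↦ (inf_le_right : FinContSet.actionKer Z ⊓ N ≤ N).trans
        (FinContSet.le_actionKer_quot N)) (t ≫ a ≫ r.hom)
    rw [hy (t ≫ a ≫ r.hom) i (t ≫ a) b (by simp) hb, pullHom_map, pullHom_map]

lemma HasQuotDescent.isStack (hQ : HasQuotDescent 𝒜) (h𝒜 : CommutesWithCoproducts 𝒜) :
    𝒜.IsStack (naturalTopology G) := by
  have := hQ.isPrestack h𝒜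
  refine .of_isStackFor fun S R hR ↦ ?_
  obtain ⟨N, ι, f, hfR, hf, hf'⟩ := hQ.exists_isEquivalence h𝒜 hR
  refine IsStackFor.of_le' 𝒜 (R := Sieve.ofArrows _ f) (J := naturalTopology G) ?_
    (FinContSet.ofArrows_mem_naturalTopology f hf) ?_
  · exact (IsStackFor_generate_iff _ _).2 ((isStackFor_ofArrows_iff _ _).2 hf')
  · exact (Sieve.generate_le_iff _ _).2 (by
      rintro _ _ ⟨i⟩
      exact hfR i)

variable [∀ S : FinContSet G, Preadditive (fibre 𝒜 S)]
  [∀ S : FinContSet G, HasFiniteBiproducts (fibre 𝒜 S)]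
  [∀ {T S : FinContSet G} (f : T ⟶ S), (pull 𝒜 f).Additive]

lemma exists_nsmul_eq_id_of_linear_localization {D : Type*} [Category* D] [Preadditive D] {n m : ℕ}
    (h : n ∣ m) [Linear (Localization.Away (m : ℤ)) D] (A : D) : ∃ c : A ⟶ A, n • c = 𝟙 A := by
  obtain ⟨k, rfl⟩ := h
  refine ⟨k • (IsLocalization.Away.invSelf ((n * k : ℕ) : ℤ) :
    Localization.Away ((n * k : ℕ) : ℤ)) • 𝟙 A, ?_⟩
  have := IsLocalization.Away.mul_invSelf (S := Localization.Away ((n * k : ℕ) : ℤ))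
    ((n * k : ℕ) : ℤ)
  rw [← mul_smul, ← Nat.cast_smul_eq_nsmul (Localization.Away ((n * k : ℕ) : ℤ)), ← mul_smul]
  rw [map_natCast] at this
  rw [this, one_smul]

lemma exists_nsmul_eq_id_of_linear_rat {D : Type*} [Category* D] [Preadditive D] {n : ℕ}
    (h : n ≠ 0) [Linear ℚ D] (A : D) : ∃ c : A ⟶ A, n • c = 𝟙 A := by
  refine ⟨(n : ℚ)⁻¹ • 𝟙 A, ?_⟩
  rw [← Nat.cast_smul_eq_nsmul ℚ, ← mul_smul, mul_inv_cancel₀ (by exact_mod_cast h), one_smul]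

lemma hasQuotDescent_of_isCartesianWithTrace
    (h₁ : ∀ S : FinContSet G, IsIdempotentComplete (fibre 𝒜 S))
    (h₂ : (∀ {T P : FinContSet G} (f : T ⟶ P), IsGaloisCovering f → Nonempty (IsTerminal P) →
          ∀ S : FinContSet G,
            Nonempty (Linear (Localization.Away (Nat.card (Gal f) : ℤ)) (fibre 𝒜 S))) ∨
        (∀ S : FinContSet G, Nonempty (Linear ℚ (fibre 𝒜 S))))
    (h𝒜 : CommutesWithCoproducts 𝒜)
    (h₃ : ∀ {T S : FinContSet G} (f : T ⟶ S), IsGaloisCovering f → IsCartesianWithTrace 𝒜 f) :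
    HasQuotDescent 𝒜 := by
  intro N S hS t
  have ht := FinContSet.isGaloisCovering_of_quot hS t
  refine (h₃ t ht).isEquivalence_toDescentData (fun A ↦ ?_) h𝒜 ht
  obtain h₂ | h₂ := h₂
  -- Linearity is assumed only for coverings of the point, so the degree of `t` is inverted through
  -- a multiple of it.
  · obtain ⟨P, hP, p, hp, hd⟩ := FinContSet.exists_card_gal_dvd t
    obtain ⟨_⟩ := h₂ p hp ⟨hP⟩ S
    exact exists_nsmul_eq_id_of_linear_localization hd A
  · obtain ⟨_⟩ := h₂ S
    exact exists_nsmul_eq_id_of_linear_rat Nat.card_pos.ne' A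

end

end BPi

/-! ### Stacks commute with coproducts -/

namespace BPi

open Pseudofunctor Pseudofunctor.LocallyDiscreteOpToCat

section

variable {G : Type u} [Group G] [TopologicalSpace G] [IsTopologicalGroup G] [CompactSpace G]
  (𝒜 : LocallyDiscrete (FinContSet G)ᵒᵖ ⥤ᵖ Cat.{v', u'}) [𝒜.IsStack (naturalTopology G)]

/-- The empty family covers the empty set, and descent data for it carry no information. -/
lemma hom_ext_of_isStack_of_isEmpty {Y : FinContSet G} [IsEmpty Y.obj.V] {M N : fibre 𝒜 Y}
    (x y : M ⟶ N) : x = y := by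
  have := 𝒜.isEquivalence_toDescentData (J := naturalTopology G)
    (fun i : Empty ↦ (i.elim : (i.elim : FinContSet G) ⟶ Y))
    (FinContSet.ofArrows_mem_naturalTopology _ isEmptyElim)
  exact (𝒜.toDescentData (fun i : Empty ↦ (i.elim : (i.elim : FinContSet G) ⟶ Y))).map_injective
    (DescentData.hom_ext fun i ↦ i.elim)

section

variable {ι : Type} [Finite ι] {X : ι → FinContSet G} {c : Cofan X} (hc : IsColimit c)

variable {𝒜} in
/-- The descent datum relative to a coproduct which is attached to
a family of objects over each summand. -/
noncomputable def descentDataOfIsColimit [∀ S : FinContSet G, Preadditive (fibre 𝒜 S)]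
    (M : ∀ i, fibre 𝒜 (X i)) : 𝒜.DescentData c.inj :=
  have H ⦃Y : FinContSet G⦄ ⦃q : Y ⟶ c.pt⦄ ⦃i : ι⦄ ⦃f₁ f₂ : Y ⟶ X i⦄ (h₁ : f₁ ≫ c.inj i = q)
    (h₂ : f₂ ≫ c.inj i = q) : f₁ = f₂ := FinContSet.mono_inj hc (h₁.trans h₂.symm)
  { obj := M
    hom := fun Y q i₁ i₂ f₁ f₂ h₁ h₂ ↦ open Classical in
      -- For distinct indices `Y` is empty and all parallel morphisms agree, so 0 is just a default
      -- value.
      if h : i₁ = i₂ then eqToHom (by subst h; rw [H h₁ h₂]) else 0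
    pullHom_hom := fun Y' Y g q q' hq i₁ i₂ f₁ f₂ hf₁ hf₂ gf₁ gf₂ hgf₁ hgf₂ ↦ by
      by_cases h : i₁ = i₂
      · subst h
        obtain rfl := H hf₁ hf₂
        obtain rfl : gf₁ = gf₂ := by rw [← hgf₁, hgf₂]
        simp only [dite_true, eqToHom_refl]
        exact pullHom_id_hom _ _ _ _ _
      · have := FinContSet.isEmpty_of_ne hc h gf₁ gf₂ (by
          rw [← hgf₁, ← hgf₂, Category.assoc, Category.assoc, hf₁, hf₂])
        exact hom_ext_of_isStack_of_isEmpty 𝒜 _ _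
    hom_self := fun Y q i g hg ↦ by simp
    hom_comp := fun Y q i₁ i₂ i₃ f₁ f₂ f₃ h₁ h₂ h₃ ↦ by
      by_cases h : i₁ = i₂
      · by_cases h' : i₂ = i₃
        · subst h h'
          simp
        · have := FinContSet.isEmpty_of_ne hc h' f₂ f₃ (by rw [h₂, h₃])
          exact hom_ext_of_isStack_of_isEmpty 𝒜 _ _
      · have := FinContSet.isEmpty_of_ne hc h f₁ f₂ (by rw [h₁, h₂])
        exact hom_ext_of_isStack_of_isEmpty 𝒜 _ _ }

end

lemma commutesWithCoproducts_of_isStack [∀ S : FinContSet G, Preadditive (fibre 𝒜 S)] :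
    CommutesWithCoproducts 𝒜 := by
  intro ι _ X c ⟨hc⟩
  have := 𝒜.isEquivalence_toDescentData (J := naturalTopology G) c.inj
    (FinContSet.ofArrows_mem_naturalTopology _ fun s ↦ by
      obtain ⟨⟨i, x⟩, h⟩ := (FinContSet.bijective_of_isColimit hc).2 s
      exact ⟨i, x, h⟩)
  have : (Functor.pi' fun i ↦ pull 𝒜 (c.inj i)).Faithful := ⟨fun {A B x y} h ↦
    (𝒜.toDescentData c.inj).map_injective (DescentData.hom_ext fun i ↦ congr_fun h i)⟩
  have : (Functor.pi' fun i ↦ pull 𝒜 (c.inj i)).Full := ⟨fun {A B} φ ↦ by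
    obtain ⟨ψ, hψ⟩ := (exists_toDescentData_obj_hom_iff 𝒜 c.inj (A := A) (B := B) φ).2
      (fun Y q i₁ i₂ f₁ f₂ h₁ h₂ ↦ by
        by_cases h : i₁ = i₂
        · subst h
          obtain rfl : f₁ = f₂ := FinContSet.mono_inj hc (by rw [h₁, h₂])
          rfl
        · have := FinContSet.isEmpty_of_ne hc h f₁ f₂ (by rw [h₁, h₂])
          exact hom_ext_of_isStack_of_isEmpty 𝒜 _ _)
    obtain ⟨x, hx⟩ := (𝒜.toDescentData c.inj).map_surjective ψ
    exact ⟨x, (congr_arg DescentData.Hom.hom hx).trans hψ⟩⟩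
  have : (Functor.pi' fun i ↦ pull 𝒜 (c.inj i)).EssSurj := ⟨fun M ↦ by
    let e := (𝒜.toDescentData c.inj).objObjPreimageIso (descentDataOfIsColimit hc M)
    exact ⟨_, ⟨{
      hom := e.hom.hom
      inv := e.inv.hom
      hom_inv_id := congr_arg DescentData.Hom.hom e.hom_inv_id
      inv_hom_id := congr_arg DescentData.Hom.hom e.inv_hom_id }⟩⟩⟩
  exact { }

end

end BPi

/-! ### The descent datum `⨁ g, g^* M` relative to a Galois covering -/

namespace BPi

open Pseudofunctor Pseudofunctor.LocallyDiscreteOpToCat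

lemma gal_left_comp_mul_inv {C : Type u} [Category.{v} C] {T S : C} {f : T ⟶ S} (g m : Gal f) :
    g.hom.left ≫ (m * g⁻¹).hom.left = m.hom.left := by
  change (m * g⁻¹ * g).hom.left = _
  rw [inv_mul_cancel_right]

section

variable {C : Type u} [Category.{v} C] {𝒜 : LocallyDiscrete Cᵒᵖ ⥤ᵖ Cat.{v', u'}}
  {T S : C} {f : T ⟶ S} [∀ S : C, Preadditive (fibre 𝒜 S)]
  [∀ S : C, HasFiniteBiproducts (fibre 𝒜 S)]

section

variable [Finite (Gal f)] (f) (M : fibre 𝒜 T)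

/-- The direct sum of the pullbacks of an object by the elements of the Galois group. -/
noncomputable abbrev galSum : fibre 𝒜 T := ⨁ fun g : Gal f ↦ (pull 𝒜 g.hom.left).obj M

variable {f}

/-- The projection `g^* (⨁ k, k^* M) ⟶ m^* M`. -/
noncomputable def galProj (g m : Gal f) :
    (pull 𝒜 g.hom.left).obj (galSum f M) ⟶ (pull 𝒜 m.hom.left).obj M :=
  -- Since `g^* k^* M ≅ (k * g)^* M`, the summand `m^* M` comes from `k = m * g⁻¹`.
  pullHom ((pullId (galSum f M)).hom ≫ biproduct.π _ (m * g⁻¹)) g.hom.left g.hom.left m.hom.left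
    (Category.comp_id _) (gal_left_comp_mul_inv g m)

/-- The inclusion `m^* M ⟶ g^* (⨁ k, k^* M)`. -/
noncomputable def galIncl (g m : Gal f) :
    (pull 𝒜 m.hom.left).obj M ⟶ (pull 𝒜 g.hom.left).obj (galSum f M) :=
  pullHom (biproduct.ι (fun g : Gal f ↦ (pull 𝒜 g.hom.left).obj M) (m * g⁻¹) ≫
      (pullId (galSum f M)).inv) g.hom.left m.hom.left g.hom.left
    (gal_left_comp_mul_inv g m) (Category.comp_id _)

lemma pullHom_galProj (g m k : Gal f) :
    pullHom (galProj M g m) k.hom.left (g * k).hom.left (m * k).hom.left rfl rfl =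
      galProj M (g * k) (m * k) := by
  -- Transport along `(m * k) * (g * k)⁻¹ = m * g⁻¹`, which is not definitional.
  have aux {k₁ k₂ : Gal f} (h : k₁ = k₂) {Y : C} (b : Y ⟶ T) (a : Y ⟶ T)
      (h₁ : b ≫ k₁.hom.left = a) (h₂ : b ≫ k₂.hom.left = a) :
      pullHom ((pullId (galSum f M)).hom ≫ biproduct.π _ k₁) b b a (Category.comp_id _) h₁ =
      pullHom ((pullId (galSum f M)).hom ≫ biproduct.π _ k₂) b b a (Category.comp_id _) h₂ := by
    subst h
    rfl
  exact (pullHom_pullHom _ _ _ _ _ _ _ (Category.comp_id _) (gal_left_comp_mul_inv g m)).trans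
    (aux (by simp) _ _ _ _)

lemma pullHom_galIncl (g m k : Gal f) :
    pullHom (galIncl M g m) k.hom.left (m * k).hom.left (g * k).hom.left rfl rfl =
      galIncl M (g * k) (m * k) := by
  have aux {k₁ k₂ : Gal f} (h : k₁ = k₂) {Y : C} (b : Y ⟶ T) (a : Y ⟶ T)
      (h₁ : b ≫ k₁.hom.left = a) (h₂ : b ≫ k₂.hom.left = a) :
      pullHom (biproduct.ι (fun g : Gal f ↦ (pull 𝒜 g.hom.left).obj M) k₁ ≫
        (pullId (galSum f M)).inv) b a b h₁ (Category.comp_id _) =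
      pullHom (biproduct.ι (fun g : Gal f ↦ (pull 𝒜 g.hom.left).obj M) k₂ ≫
        (pullId (galSum f M)).inv) b a b h₂ (Category.comp_id _) := by
    subst h
    rfl
  exact (pullHom_pullHom _ _ _ _ _ _ _ (gal_left_comp_mul_inv g m) (Category.comp_id _)).trans
    (aux (by simp) _ _ _ _)

lemma galIncl_galProj_self (g m : Gal f) : galIncl M g m ≫ galProj M g m = 𝟙 _ := by
  rw [galIncl, galProj, ← pullHom_comp, Category.assoc, Iso.inv_hom_id_assoc, biproduct.ι_π_self,
    pullHom_id_hom]

variable [∀ {T S : C} (f : T ⟶ S), (pull 𝒜 f).Additive]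

lemma galIncl_galProj_of_ne (g : Gal f) {m m' : Gal f} (h : m ≠ m') :
    galIncl M g m ≫ galProj M g m' = 0 := by
  rw [galIncl, galProj, ← pullHom_comp, Category.assoc, Iso.inv_hom_id_assoc, biproduct.ι_π_ne,
    pullHom_zero]
  simpa using h

variable [Fintype (Gal f)]

lemma sum_galProj_galIncl (g : Gal f) : ∑ m, galProj M g m ≫ galIncl M g m = 𝟙 _ := by
  simp only [galProj, galIncl, ← pullHom_comp]
  rw [← pullHom_sum]
  have h₁ : ∑ m, ((pullId (galSum f M)).hom ≫ biproduct.π _ (m * g⁻¹)) ≫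
      biproduct.ι (fun g : Gal f ↦ (pull 𝒜 g.hom.left).obj M) (m * g⁻¹) ≫
        (pullId (galSum f M)).inv = 𝟙 _ := by
    refine (Equiv.sum_comp (Equiv.mulRight g⁻¹) (fun k ↦ ((pullId (galSum f M)).hom ≫
      biproduct.π _ k) ≫ biproduct.ι (fun g : Gal f ↦ (pull 𝒜 g.hom.left).obj M) k ≫
        (pullId (galSum f M)).inv)).trans ?_
    have h₂ := biproduct_total (fun g : Gal f ↦ (pull 𝒜 g.hom.left).obj M)
    replace h₂ := congr((pullId (galSum f M)).hom ≫ $h₂ ≫ (pullId (galSum f M)).inv)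
    simpa only [Preadditive.sum_comp, Preadditive.comp_sum, Category.assoc, Category.id_comp,
      Iso.hom_inv_id] using h₂
  rw [h₁, pullHom_id_hom]

variable (f) in
/-- The isomorphisms `g^* (⨁ k, k^* M) ⟶ h^* (⨁ k, k^* M)`. -/
noncomputable def galSumHom (g h : Gal f) :
    (pull 𝒜 g.hom.left).obj (galSum f M) ⟶ (pull 𝒜 h.hom.left).obj (galSum f M) :=
  -- Both sides are direct sums of the same `m^* M`; in these coordinates the isomorphism is the
  -- identity.
  ∑ m, galProj M g m ≫ galIncl M h m

lemma galSumHom_galProj (g h m : Gal f) : galSumHom f M g h ≫ galProj M h m = galProj M g m := by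
  rw [galSumHom, Preadditive.sum_comp, Finset.sum_eq_single m]
  · rw [Category.assoc, galIncl_galProj_self, Category.comp_id]
  · intro b _ hb
    rw [Category.assoc, galIncl_galProj_of_ne M h hb, comp_zero]
  · simp

end

end

section

variable {G : Type u} [Group G] [TopologicalSpace G] [IsTopologicalGroup G]
  {𝒜 : LocallyDiscrete (FinContSet G)ᵒᵖ ⥤ᵖ Cat.{v', u'}} {T S : FinContSet G} {f : T ⟶ S}
  [∀ S : FinContSet G, Preadditive (fibre 𝒜 S)]
  [∀ S : FinContSet G, HasFiniteBiproducts (fibre 𝒜 S)]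
  [∀ {T S : FinContSet G} (f : T ⟶ S), (pull 𝒜 f).Additive]
  [Fintype (Gal f)]

variable (f) in
/-- The Galois datum `⨁ g, g^* M`. -/
noncomputable def galSumDatum (M : fibre 𝒜 T) : GaloisDatum 𝒜 f where
  obj := galSum f M
  hom := galSumHom f M
  hom_self := sum_galProj_galIncl M
  hom_comp g h k := by
    conv_lhs => rw [galSumHom.eq_def f M h k, Preadditive.comp_sum]
    exact Finset.sum_congr rfl fun m _ ↦ by rw [← Category.assoc, galSumHom_galProj]
  pullHom_hom g h k := by
    rw [galSumHom, galSumHom, pullHom_sum]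
    refine Eq.trans ?_ (Equiv.sum_comp (Equiv.mulRight k)
      (fun m ↦ galProj M (g * k) m ≫ galIncl M (h * k) m))
    refine Finset.sum_congr rfl fun m _ ↦ ?_
    exact (pullHom_comp _ _ _ _ (m * k).hom.left _ rfl rfl rfl).trans
      (congrArg₂ (· ≫ ·) (pullHom_galProj M g m k) (pullHom_galIncl M h m k))

end

end BPi

/-! ### Stacks are Cartesian and have trace structures -/

namespace BPi

open Pseudofunctor Pseudofunctor.LocallyDiscreteOpToCat

section

variable {C : Type u} [Category.{v} C] {𝒜 : LocallyDiscrete Cᵒᵖ ⥤ᵖ Cat.{v', u'}}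
  {T S : C}

/-- An object over `S` whose pullback by `f` is the product of the pullbacks of an object `M`
by the elements of the Galois group of `f`. -/
structure GalCone (f : T ⟶ S) (M : fibre 𝒜 T) where
  obj : fibre 𝒜 S
  proj (g : Gal f) : (pull 𝒜 f).obj obj ⟶ (pull 𝒜 g.hom.left).obj M
  pullHom_proj (g k : Gal f) :
    pullHom (proj g) k.hom.left f (g * k).hom.left (gal_left_comp k) rfl = proj (g * k)
  hom_ext {N : fibre 𝒜 T} {x y : N ⟶ (pull 𝒜 f).obj obj}
    (h : ∀ g, x ≫ proj g = y ≫ proj g) : x = y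
  exists_lift {N : fibre 𝒜 T} (x : ∀ g : Gal f, N ⟶ (pull 𝒜 g.hom.left).obj M) :
    ∃ z : N ⟶ (pull 𝒜 f).obj obj, ∀ g, z ≫ proj g = x g

namespace GalCone

variable {f : T ⟶ S} {M : fibre 𝒜 T} (c : GalCone f M)

/-- The counit morphism. -/
def counit : (pull 𝒜 f).obj c.obj ⟶ M := c.proj 1 ≫ (pullId M).hom

lemma pullHom_counit (g : Gal f) :
    pullHom (c.counit ≫ (pullId M).inv) g.hom.left f g.hom.left (gal_left_comp g)
      (Category.comp_id _) = c.proj g := by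
  have h₁ : c.counit ≫ (pullId M).inv = c.proj 1 := by
    rw [counit, Category.assoc, Iso.hom_inv_id]
    exact Category.comp_id _
  have h₂ := c.pullHom_proj 1 g
  rw [h₁]
  have h₃ {g' : Gal f} (h : g' = g) (h' : g.hom.left ≫ 𝟙 T = g'.hom.left)
      (h'' : pullHom (c.proj 1) g.hom.left f g'.hom.left (gal_left_comp g) h' = c.proj g') :
      pullHom (c.proj 1) g.hom.left f g.hom.left (gal_left_comp g) (Category.comp_id _) =
        c.proj g := by
    subst h
    exact h''
  exact h₃ (one_mul g) rfl h₂

lemma comp_proj_eq {N : fibre 𝒜 S} (y : N ⟶ c.obj) (g : Gal f) :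
    (pull 𝒜 f).map y ≫ c.proj g =
      pullHom (((pull 𝒜 f).map y ≫ c.counit) ≫ (pullId M).inv) g.hom.left f g.hom.left
        (gal_left_comp g) (Category.comp_id _) := by
  rw [Category.assoc, pullHom_comp _ _ _ _ f _ (gal_left_comp g) (gal_left_comp g)
    (Category.comp_id _), pullHom_map, pullHom_counit]

/-- By equivariance the component at 1 determines the others. Conversely, the conjugates of `x` are
the components of a Γ-invariant map `z`, which descends by `hf`. -/
lemma bijective_map_comp_counit [(pull 𝒜 f).Faithful]
    (hf : ∀ ⦃A B : fibre 𝒜 S⦄ (x : (pull 𝒜 f).obj A ⟶ (pull 𝒜 f).obj B),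
      (∀ g : Gal f, pullHom x g.hom.left f f (gal_left_comp g) (gal_left_comp g) = x) →
      ∃ y : A ⟶ B, (pull 𝒜 f).map y = x) (N : fibre 𝒜 S) :
    Function.Bijective (fun y : N ⟶ c.obj ↦ (pull 𝒜 f).map y ≫ c.counit) := by
  refine ⟨fun y y' h ↦ (pull 𝒜 f).map_injective (c.hom_ext fun g ↦ ?_), fun x ↦ ?_⟩
  · dsimp only at h
    rw [comp_proj_eq, comp_proj_eq, h]
  · obtain ⟨z, hz⟩ := c.exists_lift (fun g ↦ pullHom (x ≫ (pullId M).inv) g.hom.left f g.hom.left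
      (gal_left_comp g) (Category.comp_id _))
    obtain ⟨y, rfl⟩ := hf z (fun k ↦ by
      suffices ∀ g, pullHom z k.hom.left f f (gal_left_comp k) (gal_left_comp k) ≫
          c.proj (g * k) = z ≫ c.proj (g * k) from
        c.hom_ext fun g ↦ by
          obtain ⟨g, rfl⟩ : ∃ g', g' * k = g := ⟨g * k⁻¹, inv_mul_cancel_right _ _⟩
          exact this g
      intro g
      rw [hz (g * k), ← c.pullHom_proj g k, ← pullHom_comp, hz, pullHom_pullHom]
      rfl)
    refine ⟨y, ?_⟩
    have := hz 1
    rw [comp_proj_eq] at this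
    rw [← cancel_mono (pullId M).inv]
    exact (pullHom_id _).symm.trans (this.trans (pullHom_id _))

lemma exists_adjunction (cone : ∀ M : fibre 𝒜 T, GalCone f M) [(pull 𝒜 f).Faithful]
    (hf : ∀ ⦃A B : fibre 𝒜 S⦄ (x : (pull 𝒜 f).obj A ⟶ (pull 𝒜 f).obj B),
      (∀ g : Gal f, pullHom x g.hom.left f f (gal_left_comp g) (gal_left_comp g) = x) →
      ∃ y : A ⟶ B, (pull 𝒜 f).map y = x) :
    ∃ (R : fibre 𝒜 T ⥤ fibre 𝒜 S) (adj : pull 𝒜 f ⊣ R), ∀ M,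
      (∀ {N : fibre 𝒜 T} {x y : N ⟶ (pull 𝒜 f).obj (R.obj M)},
        (∀ g, x ≫ galCounit adj M g = y ≫ galCounit adj M g) → x = y) ∧
      (∀ {N : fibre 𝒜 T} (x : ∀ g : Gal f, N ⟶ (pull 𝒜 g.hom.left).obj M),
        ∃ z : N ⟶ (pull 𝒜 f).obj (R.obj M), ∀ g, z ≫ galCounit adj M g = x g) := by
  let e (A : fibre 𝒜 S) (M : fibre 𝒜 T) : ((pull 𝒜 f).obj A ⟶ M) ≃ (A ⟶ (cone M).obj) :=
    (Equiv.ofBijective _ ((cone M).bijective_map_comp_counit hf A)).symm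
  have he (A' A M) (x : A' ⟶ A) (y : (pull 𝒜 f).obj A ⟶ M) :
      e A' M ((pull 𝒜 f).map x ≫ y) = x ≫ e A M y := by
    refine (e A' M).symm.injective ?_
    rw [Equiv.symm_apply_apply]
    change _ = (pull 𝒜 f).map (x ≫ e A M y) ≫ (cone M).counit
    rw [Functor.map_comp, Category.assoc]
    exact congrArg ((pull 𝒜 f).map x ≫ ·) ((e A M).symm_apply_apply y).symm
  let adj := Adjunction.adjunctionOfEquivRight e he
  have h₁ (M) : adj.counit.app M = (cone M).counit := by
    refine (Adjunction.adjunctionOfEquivRight_counit_app e he M).trans ?_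
    change (pull 𝒜 f).map (𝟙 _) ≫ (cone M).counit = _
    rw [CategoryTheory.Functor.map_id]
    exact Category.id_comp _
  have h₂ (M) (g : Gal f) : galCounit adj M g = (cone M).proj g := by
    rw [galCounit, h₁]
    exact (cone M).pullHom_counit g
  refine ⟨_, adj, fun M ↦ ⟨fun {N x y} h ↦ (cone M).hom_ext fun g ↦ ?_, fun {N} x ↦ ?_⟩⟩
  · rw [← h₂]
    exact h g
  · obtain ⟨z, hz⟩ := (cone M).exists_lift x
    refine ⟨z, fun g ↦ ?_⟩
    rw [h₂]
    exact hz g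

end GalCone

end

/-! ### Right adjoints and traces obtained by descent -/

section

variable {G : Type u} [Group G] [TopologicalSpace G] [IsTopologicalGroup G]
  {𝒜 : LocallyDiscrete (FinContSet G)ᵒᵖ ⥤ᵖ Cat.{v', u'}} {T S : FinContSet G} {f : T ⟶ S}

lemma GaloisDatum.exists_isIso (D : GaloisDatum 𝒜 f) (h𝒜 : CommutesWithCoproducts 𝒜)
    (hf : IsGaloisCovering f) [(𝒜.toDescentData (fun _ : Unit ↦ f)).EssSurj] :
    ∃ (A : fibre 𝒜 S) (θ : (pull 𝒜 f).obj A ⟶ (pull 𝒜 (1 : Gal f).hom.left).obj D.obj),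
      IsIso θ ∧ ∀ g h : Gal f,
        pullHom θ g.hom.left f g.hom.left (gal_left_comp g) (Category.comp_id _) ≫ D.hom g h =
          pullHom θ h.hom.left f h.hom.left (gal_left_comp h) (Category.comp_id _) := by
  let e := (𝒜.toDescentData (fun _ : Unit ↦ f)).objObjPreimageIso (D.descentData h𝒜 hf)
  let A := (𝒜.toDescentData (fun _ : Unit ↦ f)).objPreimage (D.descentData h𝒜 hf)
  let θ : (pull 𝒜 f).obj A ⟶ D.obj := e.hom.hom ()
  have : IsIso θ := ⟨e.inv.hom (), congr_fun (congr_arg DescentData.Hom.hom e.hom_inv_id) (),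
    congr_fun (congr_arg DescentData.Hom.hom e.inv_hom_id) ()⟩
  have hθ (g h : Gal f) : (pull 𝒜 g.hom.left).map θ ≫ D.hom g h =
      ((pullComp g.hom.left f f (gal_left_comp g) A).hom ≫
        (pullComp h.hom.left f f (gal_left_comp h) A).inv) ≫ (pull 𝒜 h.hom.left).map θ := by
    rw [← D.descentData_hom h𝒜 hf g h (gal_left_comp g) (gal_left_comp h)]
    exact e.hom.comm f g.hom.left h.hom.left (gal_left_comp g) (gal_left_comp h)
  refine ⟨A, θ ≫ (pullId D.obj).inv, inferInstance, fun g h ↦ ?_⟩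
  have h₁ (g : Gal f) := pullHom_comp_pullId_inv θ g.hom.left f (gal_left_comp g)
    (Category.comp_id _)
  refine (congrArg (· ≫ D.hom g h) (h₁ g)).trans (Eq.trans ?_ (h₁ h).symm)
  rw [Category.assoc, hθ, Category.assoc, Iso.inv_hom_id_assoc]

lemma exists_map_eq_of_full [(𝒜.toDescentData (fun _ : Unit ↦ f)).Full]
    (h𝒜 : CommutesWithCoproducts 𝒜) (hf : IsGaloisCovering f) {A B : fibre 𝒜 S}
    (x : (pull 𝒜 f).obj A ⟶ (pull 𝒜 f).obj B)
    (hx : ∀ g : Gal f, pullHom x g.hom.left f f (gal_left_comp g) (gal_left_comp g) = x) :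
    ∃ y : A ⟶ B, (pull 𝒜 f).map y = x := by
  obtain ⟨φ, hφ⟩ := h𝒜.exists_descentData_hom hf
    (D₁ := (𝒜.toDescentData (fun _ : Unit ↦ f)).obj A)
    (D₂ := (𝒜.toDescentData (fun _ : Unit ↦ f)).obj B) x (fun g ↦
      (pullHom_eq_pullHom_iff (gal_left_comp g) (Category.id_comp f) x x).1
        ((hx g).trans (pullHom_id x).symm))
  obtain ⟨y, hy⟩ := (𝒜.toDescentData (fun _ : Unit ↦ f)).map_surjective φ
  exact ⟨y, (congr_fun (congr_arg DescentData.Hom.hom hy) ()).trans hφ⟩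

variable [∀ S : FinContSet G, Preadditive (fibre 𝒜 S)]
  [∀ S : FinContSet G, HasFiniteBiproducts (fibre 𝒜 S)]
  [∀ {T S : FinContSet G} (f : T ⟶ S), (pull 𝒜 f).Additive]

/-- The object is the descent of `⨁ g, g^* M`, and its projections are those of the direct sum
transported by `θ`. -/
lemma nonempty_galCone (h𝒜 : CommutesWithCoproducts 𝒜)
    (hf : IsGaloisCovering f) [(𝒜.toDescentData (fun _ : Unit ↦ f)).EssSurj] (M : fibre 𝒜 T) :
    Nonempty (GalCone f M) := by
  have := Fintype.ofFinite (Gal f)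
  obtain ⟨A, θ, hθ, h⟩ : ∃ (A : fibre 𝒜 S)
      (θ : (pull 𝒜 f).obj A ⟶ (pull 𝒜 (1 : Gal f).hom.left).obj (galSum f M)),
      IsIso θ ∧ ∀ g h : Gal f,
        pullHom θ g.hom.left f g.hom.left (gal_left_comp g) (Category.comp_id _) ≫
            galSumHom f M g h =
          pullHom θ h.hom.left f h.hom.left (gal_left_comp h) (Category.comp_id _) :=
    (galSumDatum f M).exists_isIso h𝒜 hf
  have h₁ : pullHom θ (1 : Gal f).hom.left f (1 : Gal f).hom.left (gal_left_comp 1)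
    (Category.comp_id _) = θ := pullHom_id θ
  refine ⟨{
    obj := A
    proj := fun g ↦ θ ≫ galProj M 1 g
    pullHom_proj := fun g k ↦ ?_
    hom_ext := fun {N x y} hxy ↦ ?_
    exists_lift := fun {N} x ↦ ?_ }⟩
  · have h₂ := h k 1
    rw [h₁] at h₂
    have h₃ {k' : Gal f} (hk : k' = k) (h₁ : k.hom.left ≫ 𝟙 T = k'.hom.left)
        (h₂ : pullHom (galProj M 1 g) k.hom.left k'.hom.left (g * k).hom.left h₁ rfl =
          galProj M k' (g * k)) :
        pullHom (galProj M 1 g) k.hom.left k.hom.left (g * k).hom.left (Category.comp_id _) rfl =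
          galProj M k (g * k) := by
      subst hk
      exact h₂
    refine (pullHom_comp _ _ _ _ k.hom.left _ (gal_left_comp k) (Category.comp_id _) rfl).trans ?_
    refine (congrArg (_ ≫ ·) ((h₃ (one_mul k) rfl (pullHom_galProj M 1 g k)).trans
      (galSumHom_galProj M k 1 (g * k)).symm)).trans ?_
    exact (Category.assoc _ _ _).symm.trans (congrArg (· ≫ galProj M 1 (g * k)) h₂)
  · rw [← cancel_mono θ, ← Category.comp_id (x ≫ θ), ← Category.comp_id (y ≫ θ),
      ← sum_galProj_galIncl, Preadditive.comp_sum, Preadditive.comp_sum]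
    refine Finset.sum_congr rfl fun m _ ↦ ?_
    have := hxy m =≫ galIncl M 1 m
    simpa only [Category.assoc] using this
  · refine ⟨(∑ m, x m ≫ galIncl M 1 m) ≫ inv θ, fun g ↦ ?_⟩
    rw [Category.assoc, IsIso.inv_hom_id_assoc, Preadditive.sum_comp, Finset.sum_eq_single g]
    · rw [Category.assoc, galIncl_galProj_self, Category.comp_id]
    · intro b _ hb
      rw [Category.assoc, galIncl_galProj_of_ne M 1 hb, comp_zero]
    · simp

/-- Translation permutes the conjugates of the counit, so their sum is invariant and descends.
Naturality and the first axiom are checked after the faithful `f^*`, each conjugate of the triangle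
identity contributing 1; the second axiom is the construction itself. -/
lemma nonempty_traceStructure [(𝒜.toDescentData (fun _ : Unit ↦ f)).Full] [(pull 𝒜 f).Faithful]
    (h𝒜 : CommutesWithCoproducts 𝒜) (hf : IsGaloisCovering f) {R : fibre 𝒜 T ⥤ fibre 𝒜 S}
    (adj : pull 𝒜 f ⊣ R) : Nonempty (TraceStructure adj) := by
  have := Fintype.ofFinite (Gal f)
  have h₁ (A : fibre 𝒜 S) : ∃ y : R.obj ((pull 𝒜 f).obj A) ⟶ A, (pull 𝒜 f).map y =
      ∑ g : Gal f, pullHom (adj.counit.app ((pull 𝒜 f).obj A)) g.hom.left f f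
        (gal_left_comp g) (gal_left_comp g) := by
    refine exists_map_eq_of_full h𝒜 hf _ fun k ↦ ?_
    rw [pullHom_sum]
    refine Eq.trans ?_ (Equiv.sum_comp (Equiv.mulRight k)
      (fun g : Gal f ↦ pullHom (adj.counit.app ((pull 𝒜 f).obj A)) g.hom.left f f
        (gal_left_comp g) (gal_left_comp g)))
    refine Finset.sum_congr rfl fun g _ ↦ ?_
    rw [pullHom_pullHom]
    rfl
  choose tr htr using h₁
  refine ⟨{
    tr := { app := tr, naturality := fun A B y ↦ (pull 𝒜 f).map_injective ?_ }
    unit_tr := fun A ↦ (pull 𝒜 f).map_injective ?_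
    map_tr := fun A ↦ ?_ }⟩
  · change (pull 𝒜 f).map (R.map ((pull 𝒜 f).map y) ≫ tr B) = (pull 𝒜 f).map (tr A ≫ y)
    rw [Functor.map_comp, Functor.map_comp, htr, htr, Preadditive.comp_sum, Preadditive.sum_comp]
    refine Finset.sum_congr rfl fun g _ ↦ ?_
    have h₂ := adj.counit.naturality ((pull 𝒜 f).map y)
    dsimp only [Functor.comp_map, Functor.id_map] at h₂
    have := congr(pullHom $h₂ g.hom.left f f (gal_left_comp g) (gal_left_comp g))
    rwa [pullHom_comp _ _ _ _ f _ (gal_left_comp g) (gal_left_comp g) (gal_left_comp g),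
      pullHom_comp _ _ _ _ f _ (gal_left_comp g) (gal_left_comp g) (gal_left_comp g),
      pullHom_map, pullHom_map] at this
  · change (pull 𝒜 f).map (adj.unit.app A ≫ tr A) = (pull 𝒜 f).map (Nat.card (Gal f) • 𝟙 A)
    rw [Functor.map_comp, htr, Preadditive.comp_sum, Functor.map_nsmul,
      CategoryTheory.Functor.map_id, Nat.card_eq_fintype_card]
    refine (Finset.sum_congr rfl fun g _ ↦ ?_).trans (Finset.sum_const _)
    have h₂ := adj.left_triangle_components A
    have := congr(pullHom $h₂ g.hom.left f f (gal_left_comp g) (gal_left_comp g))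
    rwa [pullHom_comp _ _ _ _ f _ (gal_left_comp g) (gal_left_comp g) (gal_left_comp g),
      pullHom_map, pullHom_id_hom] at this
  · rw [biproduct_desc_eq_sum, Preadditive.comp_sum]
    simp only [Category.comp_id]
    exact (htr A).trans (Finset.sum_congr rfl fun g _ ↦ (cartesianMapPull_π adj A g).symm)

lemma isCartesianWithTrace_of_isStack [CompactSpace G] [𝒜.IsStack (naturalTopology G)]
    (hf : IsGaloisCovering f) : IsCartesianWithTrace 𝒜 f := by
  have h𝒜 := commutesWithCoproducts_of_isStack 𝒜
  have := 𝒜.isEquivalence_toDescentData (J := naturalTopology G) (fun _ : Unit ↦ f)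
    (FinContSet.ofArrows_mem_naturalTopology _ fun s ↦ by
      have := hf.target.isPretransitive
      obtain ⟨t⟩ := hf.source.nonempty
      obtain ⟨g, hg⟩ := MulAction.exists_smul_eq G (f.hom.hom t) s
      exact ⟨(), g • t, by rw [FinContSet.hom_smul, hg]⟩)
  have : (pull 𝒜 f).Faithful := ⟨fun {A B x y} h ↦
    (𝒜.toDescentData (fun _ : Unit ↦ f)).map_injective (DescentData.hom_ext fun _ ↦ h)⟩
  obtain ⟨R, adj, h⟩ := GalCone.exists_adjunction
    (fun M ↦ (nonempty_galCone h𝒜 hf M).some) (fun A B x ↦ exists_map_eq_of_full h𝒜 hf x)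
  refine ⟨R, adj, fun M ↦ ?_, nonempty_traceStructure h𝒜 hf adj⟩
  obtain ⟨h₁, h₂⟩ := h M
  -- The inverse of the Cartesian map is the lift of the biproduct projections.
  obtain ⟨z, hz⟩ := h₂ (fun g ↦ biproduct.π (fun g : Gal f ↦ (pull 𝒜 g.hom.left).obj M) g)
  refine ⟨z, h₁ fun g ↦ ?_, biproduct.hom_ext _ _ fun g ↦ ?_⟩
  · rw [Category.assoc, hz, cartesianMap_π, Category.id_comp]
  · rw [Category.assoc, cartesianMap_π, hz, Category.id_comp]

end

end BPi

theorem theoremp5p3 {G : Type u} [Group G] [TopologicalSpace G] [IsTopologicalGroup G]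
    [CompactSpace G] [TotallyDisconnectedSpace G]
    (𝒜 : LocallyDiscrete (BPi.FinContSet G)ᵒᵖ ⥤ᵖ Cat.{v', u'})
    [∀ S : BPi.FinContSet G, Preadditive (BPi.fibre 𝒜 S)]
    [∀ S : BPi.FinContSet G, HasFiniteBiproducts (BPi.fibre 𝒜 S)]
    [∀ {T S : BPi.FinContSet G} (f : T ⟶ S), (BPi.pull 𝒜 f).Additive] :
    (𝒜.IsStack (BPi.naturalTopology G) →
      BPi.CommutesWithCoproducts 𝒜 ∧
      ∀ {T S : BPi.FinContSet G} (f : T ⟶ S), BPi.IsGaloisCovering f →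
        BPi.IsCartesianWithTrace 𝒜 f) ∧
    ((∀ S : BPi.FinContSet G, IsIdempotentComplete (BPi.fibre 𝒜 S)) →
      ((∀ {T P : BPi.FinContSet G} (f : T ⟶ P), BPi.IsGaloisCovering f → Nonempty (IsTerminal P) →
          ∀ S : BPi.FinContSet G,
            Nonempty (Linear (Localization.Away (Nat.card (BPi.Gal f) : ℤ)) (BPi.fibre 𝒜 S))) ∨
        (∀ S : BPi.FinContSet G, Nonempty (Linear ℚ (BPi.fibre 𝒜 S)))) →
      BPi.CommutesWithCoproducts 𝒜 →
      (∀ {T S : BPi.FinContSet G} (f : T ⟶ S), BPi.IsGaloisCovering f →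
        BPi.IsCartesianWithTrace 𝒜 f) →
      𝒜.IsStack (BPi.naturalTopology G)) := by
  refine ⟨fun h ↦ ⟨BPi.commutesWithCoproducts_of_isStack 𝒜,
    fun f hf ↦ BPi.isCartesianWithTrace_of_isStack hf⟩, fun h₁ h₂ h𝒜 h₃ ↦ ?_⟩
  exact (BPi.hasQuotDescent_of_isCartesianWithTrace h₁ h₂ h𝒜 h₃).isStack h𝒜
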